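/- **Setting.** Let $A^{(k)},W^{(k)}\in\mathbb R^{d\times d}$, $1\le k\le K$, with $W^{(k)}\succ 0$, and write $\Gamma^{(k)}=\sum_{t\ge 0}(A^{(k)})^tW^{(k)}((A^{(k)})^t)^\top$, $Y^{(k)}=A^{(k)}\Gamma^{(k)}$, $\|\cdot\|$ for the spectral norm and $\|\cdot\|_F$ for the Frobenius norm. Assume there are constants $\kappa_A\ge1$, $0\le\rho<1$, $\Gamma_{\max}\ge W_{\max}\ge W_{\min}>0$, $\kappa_{w,\mathrm{cross}}:=W_{\max}/W_{\min}\ge\kappa_w\ge 1$, $\Delta_{\Gamma,Y}>0$, $\Delta_{A,W}>0$ such that, for all $k$, $\|(A^{(k)})^t\|\le\kappa_A\rho^t$ for $t\ge1$; $\lambda_{\max}(\Gamma^{(k)})\le\Gamma_{\max}$; $W_{\min}\le\lambda_{\min}(W^{(k)})\le\lambda_{\max}(W^{(k)})\le W_{\max}$; $\lambda_{\max}(W^{(k)})/\lambda_{\min}(W^{(k)})\le\kappa_w$; and, for all $k<\ell$, $\|\Gamma^{(k)}-\Gamma^{(\ell)}\|_F^2+\|Y^{(k)}-Y^{(\ell)}\|_F^2\ge\Delta_{\Gamma,Y}^2$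 and $\|A^{(k)}-A^{(\ell)}\|_F^2+\|W^{(k)}-W^{(\ell)}\|_F^2/W_{\max}^2\ge\Delta_{A,W}^2$. There are $M$ trajectories $X_m=\{x_{m,t}\}_{0\le t\le T_m}$ with lengths $T_m\ge1$ and fixed labels $k_m\in\{1,\dots,K\}$, obeying $x_{m,t+1}=A^{(k_m)}x_{m,t}+w_{m,t}$ for $0\le t<T_m$, where all $w_{m,t}\sim\mathcal N(0,W^{(k_m)})$ are independent. The initial states satisfy either *Case 0:* $x_{m,0}=0$ for all $m$; or *Case 1:* $x_{1,0}=0$ and $x_{m+1,0}=x_{m,T_m}$ for $1\le m<M$. Let $\mathcal M\subseteq\{1,\dots,M\}$ be the set of trajectories to be classified; for some $p_{\min}>0$, every label $k$ is the label of at least a fraction $p_{\min}$ of the trajectories in $\mathcal M$. Let $T_{\mathrm{total}}=\sum_{m=1}^M T_m$, $0<\delta<1$ and $\iota=\log(T_{\mathrm{total}}/\delta)$. **Theorem.** There are universal constants $c_1,c_2,C_3>0$ such that the following holds in every such setting. Let $\{(\hat A^{(k)},\hat W^{(k)})\}_{1\le k\le K}$ be (random) coarse models, independent of the trajectories $\{X_m\}_{m\in\mathcal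 M}$, such that almost surely, for all $k$, $\hat W^{(k)}$ is symmetric, $\|\hat A^{(k)}-A^{(k)}\|\le\epsilon_A$ and $\|\hat W^{(k)}-W^{(k)}\|\le\epsilon_W$. Suppose that one of the following holds. * *Case 0*, with $$\epsilon_A\le c_1\Delta_{A,W}\sqrt{\frac{W_{\min}}{\Gamma_{\max}\kappa_{w,\mathrm{cross}}(d+\iota)}},\qquad \frac{\epsilon_W}{W_{\min}}\le c_2\min\Big\{1,\frac{\Delta_{A,W}}{\sqrt{\kappa_{w,\mathrm{cross}}d}}\Big\},$$ $$T_m\ge C_3\Big(\kappa_w^2+\frac{\kappa_{w,\mathrm{cross}}^6}{\Delta_{A,W}^2}\Big)\iota^2\quad\text{for all } m\in\mathcal M.$$ * *Case 1*, with $$\epsilon_A\le c_1\Delta_{A,W}\sqrt{\frac{W_{\min}}{\Gamma_{\max}\kappa_{w,\mathrm{cross}}\kappa_A^2(d+\iota)}},\qquad \frac{\epsilon_W}{W_{\min}}\le c_2\min\Big\{1,\frac{\Delta_{A,W}}{\sqrt{\kappa_{w,\mathrm{cross}}d}}\Big\},$$ $$T_m\ge C_3\Big(\kappa_w^2+\frac{\kappa_{w,\mathrm{cross}}^6}{\Delta_{A,W}^2}\Big)\iota^2+\frac{1}{1-\rho}\log(2\kappa_A)\quad\text{for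 all } m\in\mathcal M,$$ and $T_m\ge\frac1{1-\rho}\log(\sqrt2\,\kappa_A)$ for all $1\le m\le M$. Then, with probability at least $1-\delta$, for every $m\in\mathcal M$ the unique minimizer over $\ell\in\{1,\dots,K\}$ of $$T_m\log\det(\hat W^{(\ell)})+\sum_{t=0}^{T_m-1}(x_{m,t+1}-\hat A^{(\ell)}x_{m,t})^\top(\hat W^{(\ell)})^{-1}(x_{m,t+1}-\hat A^{(\ell)}x_{m,t})$$ is $\ell=k_m$; that is, every trajectory in $\mathcal M$ is classified correctly. -/

import Mathlib

open MeasureTheory ProbabilityTheory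

noncomputable section

namespace MixedLDS

/-- Real square matrices of size `d`. -/
abbrev Mat (d : ℕ) : Type := Matrix (Fin d) (Fin d) ℝ

/-- The state space `ℝ^d` with its Euclidean norm. -/
abbrev State (d : ℕ) : Type := EuclideanSpace ℝ (Fin d)

/-- The action of a matrix on the state space. -/
def act {d : ℕ} (X : Mat d) (v : State d) : State d :=
  WithLp.toLp 2 (X.mulVec v.ofLp)

/-- Spectral norm: the operator norm of a matrix on Euclidean space. -/
def specNorm {d : ℕ} (X : Mat d) : ℝ :=
  ‖Matrix.toEuclideanCLM (n := Fin d) (𝕜 := ℝ) X‖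

/-- Squared Frobenius norm. -/
def frobSq {d : ℕ} (X : Mat d) : ℝ := ∑ i, ∑ j, X i j ^ 2

/-- Largest eigenvalue (used for symmetric matrices only). -/
def lambdaMax {d : ℕ} (X : Mat d) : ℝ := sSup (spectrum ℝ X)

/-- Smallest eigenvalue (used for symmetric matrices only). -/
def lambdaMin {d : ℕ} (X : Mat d) : ℝ := sInf (spectrum ℝ X)

/-- Condition number of a positive definite matrix. -/
def condNumber {d : ℕ} (X : Mat d) : ℝ := lambdaMax X / lambdaMin X

/-- Order-0 stationary autocovariance `∑_{t ≥ 0} A^t W (A^t)ᵀ` of the system `(A, W)`. -/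
def stationaryCov {d : ℕ} (A W : Mat d) : Mat d :=
  ∑' t : ℕ, A ^ t * W * (A ^ t).transpose

/-- Order-1 stationary autocovariance `A Γ(A, W)` of the system `(A, W)`. -/
def stationaryCrossCov {d : ℕ} (A W : Mat d) : Mat d :=
  A * stationaryCov A W

/-- The standing assumptions on the ground-truth systems `(A k, W k)`, `k ∈ Fin K`:
exponential stability, conditioning of the noise and stationary covariances, and separation.
Here `κ_{w,cross}` is not a separate parameter: it is `Wmax / Wmin`. -/
structure ModelAssumptions {d K : ℕ} (A W : Fin K → Mat d)
    (κA ρ Γmax Wmax Wmin κself ΔΓY ΔAW : ℝ) : Prop where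
  one_le_κA : 1 ≤ κA
  ρ_nonneg : 0 ≤ ρ
  ρ_lt_one : ρ < 1
  stable : ∀ k, ∀ t : ℕ, 1 ≤ t → specNorm (A k ^ t) ≤ κA * ρ ^ t
  Wmin_pos : 0 < Wmin
  Wmin_le_Wmax : Wmin ≤ Wmax
  Wmax_le_Γmax : Wmax ≤ Γmax
  one_le_κself : 1 ≤ κself
  κself_le_κcross : κself ≤ Wmax / Wmin
  W_posDef : ∀ k, (W k).PosDef
  cov_le : ∀ k, lambdaMax (stationaryCov (A k) (W k)) ≤ Γmax
  Wmin_le : ∀ k, Wmin ≤ lambdaMin (W k)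
  le_Wmax : ∀ k, lambdaMax (W k) ≤ Wmax
  cond_le : ∀ k, condNumber (W k) ≤ κself
  ΔΓY_pos : 0 < ΔΓY
  ΔAW_pos : 0 < ΔAW
  separation_cov : ∀ k l, k < l →
    ΔΓY ^ 2 ≤ frobSq (stationaryCov (A k) (W k) - stationaryCov (A l) (W l))
      + frobSq (stationaryCrossCov (A k) (W k) - stationaryCrossCov (A l) (W l))
  separation_model : ∀ k l, k < l →
    ΔAW ^ 2 ≤ frobSq (A k - A l) + frobSq (W k - W l) / Wmax ^ 2

/-- `M` trajectories `x m 0, …, x m (T m)`, the `m`-th one generated by the system with the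
deterministic label `label m`, driven by independent Gaussian noise
`w m t ∼ N(0, W (label m))`, `0 ≤ t < T m`. Values of `w m t` for `t ≥ T m` and of `x m t` for
`t > T m` are irrelevant and unconstrained. -/
structure IsMixedLDS {d K M : ℕ} {Ω : Type*} [MeasurableSpace Ω] (μ : Measure Ω)
    (A W : Fin K → Mat d) (T : Fin M → ℕ) (label : Fin M → Fin K)
    (w x : Fin M → ℕ → Ω → State d) : Prop where
  length_pos : ∀ m, 1 ≤ T m
  noise_measurable : ∀ m t, t < T m → Measurable (w m t)
  noise_law : ∀ m t, t < T m → HasLaw (w m t) (multivariateGaussian 0 (W (label m))) μ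
  noise_indep :
    iIndepFun (fun p : (Σ m : Fin M, Fin (T m)) => w p.1 (p.2 : ℕ)) μ
  dynamics : ∀ m t, t < T m → ∀ ω, x m (t + 1) ω = act (A (label m)) (x m t ω) + w m t ω

/-- Case 0: all trajectories start at the zero state. -/
def Case0 {d M : ℕ} {Ω : Type*} (x : Fin M → ℕ → Ω → State d) : Prop :=
  ∀ m ω, x m 0 ω = 0

/-- Case 1: the trajectories are consecutive segments of one continuous trajectory started at
the zero state. -/
def Case1 {d M : ℕ} {Ω : Type*} (T : Fin M → ℕ) (x : Fin M → ℕ → Ω → State d) : Prop :=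
  (∀ m : Fin M, (m : ℕ) = 0 → ∀ ω, x m 0 ω = 0) ∧
  ∀ m m' : Fin M, (m' : ℕ) = (m : ℕ) + 1 → ∀ ω, x m' 0 ω = x m (T m) ω

/-- The collection of all trajectories with index in `S`, as one random element. -/
def trajectoryData {d M : ℕ} {Ω : Type*} (T : Fin M → ℕ) (S : Finset (Fin M))
    (x : Fin M → ℕ → Ω → State d) (ω : Ω) :
    (Σ m : {m : Fin M // m ∈ S}, Fin (T m.1 + 1)) → State d :=
  fun p => x p.1.1 (p.2 : ℕ) ω

/-- The coarse models `(Ahat k, What k)`, `k ∈ Fin K`, listed through their entries, as one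
random element. -/
def coarseModels {d K : ℕ} {Ω : Type*} (Ahat What : Ω → Fin K → Mat d) (ω : Ω) :
    Fin K → Fin d → Fin d → ℝ × ℝ :=
  fun k i j => (Ahat ω k i j, What ω k i j)

/-- The classification loss
`T log det W + ∑_{t < T} (x_{t+1} - A x_t)ᵀ W⁻¹ (x_{t+1} - A x_t)` of the system `(A, W)` on the
trajectory `y 0, …, y T`. -/
def loss {d : ℕ} (T : ℕ) (y : ℕ → State d) (A W : Mat d) : ℝ :=
  T * Real.log W.det
    + ∑ t ∈ Finset.range T, inner ℝ (y (t + 1) - act A (y t))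
        (act W⁻¹ (y (t + 1) - act A (y t)))

/-- `k` is a possible output (a minimizer of the loss over all labels) of the classification rule
with coarse models `(Ahat l, What l)` on the trajectory `y 0, …, y T`. -/
def IsInferredLabel {d K : ℕ} (T : ℕ) (y : ℕ → State d) (Ahat What : Fin K → Mat d)
    (k : Fin K) : Prop :=
  ∀ l, loss T y (Ahat k) (What k) ≤ loss T y (Ahat l) (What l)

end MixedLDS

end

/-! Fix a trajectory with true system `(A, W)`, a wrong label `l` and the right label `k`. The
coarse models are independent of the data, so they may be frozen at deterministic values `(Al, Vl)`
and `(Ak, Vk)`. The residual under a surrogate is the noise plus the model error applied to the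
state (`loss_eq`), and the loss gap between `l` and `k` splits into a covariance part, a cross part
and a model-error part.

Covariance part. If `m i` are the eigenvalues of `W` relative to `Vl`, then the log-determinants
plus the mean of the quadratic noise form give `∑ (m i - 1 - log (m i))` per step, twice a Gaussian
Kullback-Leibler divergence. It is at least a multiple of `‖W - Vl‖_F²`
(`exists_relative_eigenvalues`, `sub_one_sub_log_ge`), and a chi-square Chernoff bound shows that
fluctuations consume at most half of the quadratic lower bound, up to an additive term in `u`.

Model-error part. Fresh noise enters at every step, so by a small-ball estimate the states excite
every direction: `∑ ‖(A - Al) x_t‖²` is at least of order `T * Wmin * ‖A - Al‖_F²`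
(`measure_energy_lt_le`).

Cross part. Given the past it is Gaussian, with variance controlled by the model-error energies
themselves (`inner_act_cross_le`), so an exponential supermartingale absorbs it into a quarter of
those energies.

The right surrogate costs only its own small errors, provided that the states are bounded. The
states are sub-Gaussian with proxy of order `Γmax` in Case 0 and `κA² Γmax` in Case 1, where each
segment is long enough to forget half of the inherited variance. `measure_loss_le_loss_le` assembles
these estimates, `error_lt_signal` checks that the numerical thresholds suffice, and
`measure_correctly_classified_ge` takes the union bound. -/

noncomputable section

namespace MixedLDS

/-! ### Quadratic forms, Frobenius norms and inverses -/

section LinearAlgebra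

variable {d : ℕ}

lemma act_eq_clm (X : Mat d) (v : State d) :
    act X v = Matrix.toEuclideanCLM (n := Fin d) (𝕜 := ℝ) X v := rfl

lemma act_add (X : Mat d) (u v : State d) : act X (u + v) = act X u + act X v := by
  simp [act_eq_clm]

lemma act_sub (X : Mat d) (u v : State d) : act X (u - v) = act X u - act X v := by
  simp [act_eq_clm]

lemma act_smul (X : Mat d) (a : ℝ) (v : State d) : act X (a • v) = a • act X v := by
  simp [act_eq_clm]

lemma act_zero (X : Mat d) : act X 0 = 0 := by simp [act_eq_clm]

lemma sub_act (X Y : Mat d) (v : State d) : act (X - Y) v = act X v - act Y v := by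
  simp [act_eq_clm]

lemma act_mul (X Y : Mat d) (v : State d) : act (X * Y) v = act X (act Y v) := by
  simp [act_eq_clm]

lemma act_one (v : State d) : act 1 v = v := by simp [act_eq_clm]

lemma continuous_act (X : Mat d) : Continuous (act X) :=
  (Matrix.toEuclideanCLM (n := Fin d) (𝕜 := ℝ) X).continuous

@[fun_prop]
lemma measurable_act (X : Mat d) : Measurable (act X) := (continuous_act X).measurable

lemma act_apply (X : Mat d) (v : State d) (i : Fin d) : act X v i = ∑ j, X i j * v j := rfl

lemma inner_eq_dotProduct (u v : State d) : inner ℝ u v = ∑ i, u i * v i := by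
  simp [PiLp.inner_apply, mul_comm]

lemma inner_act_left (X : Mat d) (u v : State d) :
    inner ℝ (act X u) v = inner ℝ u (act X.transpose v) := by
  simp only [inner_eq_dotProduct, act_apply, Finset.sum_mul, Finset.mul_sum,
    Matrix.transpose_apply]
  rw [Finset.sum_comm]
  exact Finset.sum_congr rfl fun i _ => Finset.sum_congr rfl fun j _ => by ring

lemma inner_act_right (X : Mat d) (u v : State d) :
    inner ℝ u (act X v) = inner ℝ (act X.transpose u) v := by
  rw [inner_act_left, Matrix.transpose_transpose]

lemma inner_act_eq (X : Mat d) (u v : State d) :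
    inner ℝ u (act X v) = u.ofLp ⬝ᵥ X.mulVec v.ofLp := by
  rw [act_eq_clm, Matrix.inner_toEuclideanCLM]

lemma norm_act_le (X : Mat d) (v : State d) : ‖act X v‖ ≤ specNorm X * ‖v‖ :=
  (Matrix.toEuclideanCLM (n := Fin d) (𝕜 := ℝ) X).le_opNorm v

lemma specNorm_nonneg (X : Mat d) : 0 ≤ specNorm X := norm_nonneg _

lemma specNorm_transpose (X : Mat d) : specNorm X.transpose = specNorm X := by
  open scoped Matrix.Norms.L2Operator in
  have h := Matrix.l2_opNorm_conjTranspose X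
  rwa [Matrix.conjTranspose_eq_transpose_of_trivial, ← Matrix.l2_opNorm_toEuclideanCLM,
    ← Matrix.l2_opNorm_toEuclideanCLM] at h

lemma norm_sq_act (X : Mat d) (v : State d) : ‖act X v‖ ^ 2 = ∑ i, (∑ j, X i j * v j) ^ 2 := by
  rw [EuclideanSpace.real_norm_sq_eq]; rfl

lemma frobSq_nonneg (X : Mat d) : 0 ≤ frobSq X :=
  Finset.sum_nonneg fun _ _ => Finset.sum_nonneg fun _ _ => sq_nonneg _

lemma frobSq_transpose (X : Mat d) : frobSq X.transpose = frobSq X := by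
  simp only [frobSq, Matrix.transpose_apply]; exact Finset.sum_comm

lemma frobSq_sub_comm (X Y : Mat d) : frobSq (X - Y) = frobSq (Y - X) := by
  simp only [frobSq, Matrix.sub_apply]
  exact Finset.sum_congr rfl fun i _ => Finset.sum_congr rfl fun j _ => by ring

lemma frobSq_add_le (X Y : Mat d) : frobSq (X + Y) ≤ 2 * frobSq X + 2 * frobSq Y := by
  simp only [frobSq, Matrix.add_apply, Finset.mul_sum, ← Finset.sum_add_distrib]
  exact Finset.sum_le_sum fun i _ => Finset.sum_le_sum fun j _ => by
    nlinarith [sq_nonneg (X i j - Y i j)]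

lemma frobSq_sub_le (X Y Z : Mat d) :
    frobSq (X - Y) ≤ 2 * frobSq (X - Z) + 2 * frobSq (Y - Z) := by
  rw [frobSq_sub_comm Y Z]
  simpa using frobSq_add_le (X - Z) (Z - Y)

/-- `X` acts on `Y` column by column, and the squared Frobenius norm is the sum of the squared
column norms; the transposes only expose the columns as the outer index. -/
lemma frobSq_mul_le {X : Mat d} {b : ℝ} (hX : ∀ v, ‖act X v‖ ^ 2 ≤ b * ‖v‖ ^ 2) (Y : Mat d) :
    frobSq (X * Y) ≤ b * frobSq Y := by
  rw [← frobSq_transpose, ← frobSq_transpose Y]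
  simp only [frobSq, Matrix.transpose_apply]
  rw [Finset.mul_sum]
  refine Finset.sum_le_sum fun j _ => ?_
  have h := hX (WithLp.toLp 2 (fun i => Y i j))
  rw [norm_sq_act, EuclideanSpace.real_norm_sq_eq] at h
  simpa [Matrix.mul_apply, Finset.mul_sum] using h

lemma frobSq_le_of_specNorm (X : Mat d) : frobSq X ≤ d * specNorm X ^ 2 := by
  have h := frobSq_mul_le (X := X) (b := specNorm X ^ 2)
    (fun v => by rw [← mul_pow]; gcongr; exact norm_act_le X v) 1
  rw [mul_one] at h
  refine h.trans (le_of_eq ?_)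
  rw [mul_comm]
  congr 1
  simp [frobSq, Matrix.one_apply]

lemma norm_act_transpose_sq_le {X : Mat d} {b : ℝ} (hX : ∀ v, ‖act X v‖ ^ 2 ≤ b * ‖v‖ ^ 2)
    (v : State d) : ‖act X.transpose v‖ ^ 2 ≤ b * ‖v‖ ^ 2 := by
  rcases eq_or_ne v 0 with rfl | hv
  · simp [act_zero]
  have hv' : 0 < ‖v‖ ^ 2 := by positivity
  have hb : 0 ≤ b := by
    by_contra hb
    nlinarith [hX v, sq_nonneg ‖act X v‖]
  have h1 : ‖act X.transpose v‖ ^ 2 ≤ ‖v‖ * ‖act X (act X.transpose v)‖ := by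
    rw [← real_inner_self_eq_norm_sq, ← inner_act_right]
    exact real_inner_le_norm _ _
  have h2 := hX (act X.transpose v)
  set y := ‖act X.transpose v‖
  have hy : 0 ≤ y := norm_nonneg _
  rcases hy.eq_or_lt with h | h
  · rw [← h]; simpa using mul_nonneg hb (sq_nonneg ‖v‖)
  have h3 : (y ^ 2) ^ 2 ≤ ‖v‖ ^ 2 * (b * y ^ 2) := by
    calc (y ^ 2) ^ 2 ≤ (‖v‖ * ‖act X (act X.transpose v)‖) ^ 2 := by gcongr
      _ = ‖v‖ ^ 2 * ‖act X (act X.transpose v)‖ ^ 2 := by ring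
      _ ≤ _ := by gcongr
  have hy2 : 0 < y ^ 2 := by positivity
  nlinarith

lemma isUnit_det_of_forall_le {X : Mat d} {a : ℝ} (ha : 0 < a)
    (h : ∀ v, a * ‖v‖ ^ 2 ≤ inner ℝ v (act X v)) : IsUnit X.det := by
  rw [isUnit_iff_ne_zero]
  intro h0
  obtain ⟨v, hv, hXv⟩ := Matrix.exists_mulVec_eq_zero_iff.2 h0
  have h1 := h (WithLp.toLp 2 v)
  have h2 : act X (WithLp.toLp 2 v) = 0 := by simp [act, hXv]
  rw [h2, inner_zero_right] at h1
  have h3 : (WithLp.toLp 2 v : State d) ≠ 0 := by simpa using hv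
  have : 0 < ‖(WithLp.toLp 2 v : State d)‖ ^ 2 := by positivity
  nlinarith

/-- Upper bound for the quadratic form of the inverse. -/
lemma inner_act_inv_le {X : Mat d} {a : ℝ} (ha : 0 < a)
    (h : ∀ v, a * ‖v‖ ^ 2 ≤ inner ℝ v (act X v)) (y : State d) :
    inner ℝ y (act X⁻¹ y) ≤ ‖y‖ ^ 2 / a := by
  have hu := isUnit_det_of_forall_le ha h
  have h1 := h (act X⁻¹ y)
  rw [← act_mul, Matrix.mul_nonsing_inv _ hu, act_one, real_inner_comm] at h1
  have h2 := sq_nonneg ‖y - a • act X⁻¹ y‖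
  have h3 := norm_sub_sq_real y (a • act X⁻¹ y)
  rw [inner_smul_right, norm_smul, mul_pow, Real.norm_eq_abs, sq_abs] at h3
  rw [le_div_iff₀ ha]
  nlinarith

lemma norm_act_inv_sq_le {X : Mat d} {a : ℝ} (ha : 0 < a)
    (h : ∀ v, a * ‖v‖ ^ 2 ≤ inner ℝ v (act X v)) (y : State d) :
    ‖act X⁻¹ y‖ ^ 2 ≤ inner ℝ y (act X⁻¹ y) / a := by
  have hu := isUnit_det_of_forall_le ha h
  have h1 := h (act X⁻¹ y)
  rw [← act_mul, Matrix.mul_nonsing_inv _ hu, act_one, real_inner_comm] at h1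
  rw [le_div_iff₀ ha]
  linarith

/-- Lower bound for the quadratic form of the inverse. -/
lemma le_inner_act_inv {X : Mat d} {a b : ℝ} (ha : 0 < a) (hb : 0 < b) (hX : X.IsSymm)
    (h : ∀ v, a * ‖v‖ ^ 2 ≤ inner ℝ v (act X v))
    (h' : ∀ v, inner ℝ v (act X v) ≤ b * ‖v‖ ^ 2) (y : State d) :
    ‖y‖ ^ 2 / b ≤ inner ℝ y (act X⁻¹ y) := by
  have hu := isUnit_det_of_forall_le ha h
  -- Positivity of the form of `X` at this `z` reads `⟪y, X⁻¹ y⟫ ≥ (2/b)‖y‖² - (1/b²)⟪y, X y⟫`, and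
  -- the last form is at most `b ‖y‖²`.
  set z := act X⁻¹ y - (1 / b) • y with hz
  have hXi : act X (act X⁻¹ y) = y := by
    rw [← act_mul, Matrix.mul_nonsing_inv _ hu, act_one]
  have h1 : 0 ≤ inner ℝ z (act X z) := le_trans (by positivity) (h z)
  have h2 : act X z = y - (1 / b) • act X y := by
    rw [hz, act_sub, act_smul, hXi]
  have h3 : inner ℝ (act X⁻¹ y) (act X y) = ‖y‖ ^ 2 := by
    rw [inner_act_right, hX.eq, hXi, real_inner_self_eq_norm_sq]
  rw [h2, hz, inner_sub_left, inner_sub_right, inner_sub_right, inner_smul_left, inner_smul_left,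
    inner_smul_right, inner_smul_right, h3, real_inner_self_eq_norm_sq, real_inner_comm] at h1
  simp only [conj_trivial] at h1
  have h4 := h' y
  have h5 : 1 / b * (1 / b * inner ℝ y (act X y)) ≤ 1 / b * (1 / b * (b * ‖y‖ ^ 2)) := by gcongr
  have h6 : 1 / b * (1 / b * (b * ‖y‖ ^ 2)) = ‖y‖ ^ 2 / b := by field_simp
  have h7 : 1 / b * ‖y‖ ^ 2 = ‖y‖ ^ 2 / b := by ring
  linarith

lemma inner_act_le_of_lambdaMax {X : Mat d} (hX : X.IsSymm) {b : ℝ} (h : lambdaMax X ≤ b)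
    (v : State d) : inner ℝ v (act X v) ≤ b * ‖v‖ ^ 2 := by
  have hH : X.IsHermitian := by
    rwa [Matrix.IsHermitian, Matrix.conjTranspose_eq_transpose_of_trivial]
  have hb : ∀ i, hH.eigenvalues i ≤ b := fun i =>
    (le_csSup (Matrix.finite_real_spectrum).bddAbove (hH.eigenvalues_mem_spectrum_real i)).trans h
  have h1 : inner ℝ v (act X v)
      = ∑ i, hH.eigenvalues i * (inner ℝ (hH.eigenvectorBasis i) v) ^ 2 := by
    rw [← hH.eigenvectorBasis.sum_inner_mul_inner]
    refine Finset.sum_congr rfl fun i _ => ?_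
    have : act X (hH.eigenvectorBasis i) = hH.eigenvalues i • hH.eigenvectorBasis i := by
      rw [act, hH.mulVec_eigenvectorBasis]; rfl
    rw [inner_act_right, hX.eq, this, inner_smul_left, real_inner_comm]
    simp only [conj_trivial]; ring
  rw [h1, ← hH.eigenvectorBasis.sum_sq_inner_right v, Finset.mul_sum]
  exact Finset.sum_le_sum fun i _ => mul_le_mul_of_nonneg_right (hb i) (sq_nonneg _)

lemma le_inner_act_of_lambdaMin {X : Mat d} (hX : X.IsSymm) {a : ℝ} (h : a ≤ lambdaMin X)
    (v : State d) : a * ‖v‖ ^ 2 ≤ inner ℝ v (act X v) := by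
  have h1 := inner_act_le_of_lambdaMax (X := -X) hX.neg (b := -a) (by
    have : lambdaMax (-X) = - lambdaMin X := by
      rw [lambdaMax, lambdaMin, ← spectrum.neg_eq, Real.sInf_def, neg_neg]
    linarith) v
  have h2 : act (-X) v = - act X v := by simp [act_eq_clm]
  rw [h2, inner_neg_right] at h1
  linarith

/-- Simultaneous diagonalization of two positive definite forms by a congruence. -/
lemma exists_simultaneous_diagonalization {W P : Mat d} (hW : W.PosDef) (hP : P.PosDef) :
    ∃ (R : Mat d) (m : Fin d → ℝ), R * R.transpose = W ∧
      R.transpose * P * R = Matrix.diagonal m ∧ ∀ i, 0 < m i := by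
  open scoped MatrixOrder in
  set Q := CFC.sqrt W with hQ
  have hQQ : Q * Q = W := CFC.sqrt_mul_sqrt_self _ hW.posSemidef.nonneg
  have hQs : Q.transpose = Q := by
    have h : IsSelfAdjoint Q := (CFC.sqrt_nonneg W).isSelfAdjoint
    rwa [IsSelfAdjoint, Matrix.star_eq_conjTranspose,
      Matrix.conjTranspose_eq_transpose_of_trivial] at h
  have hQu : IsUnit Q := by
    have : IsUnit (Q * Q) := hQQ ▸ hW.isUnit
    exact isUnit_of_mul_isUnit_left this
  have hN : (Q * P * Q).PosDef := by
    have h := (Matrix.IsUnit.posDef_star_left_conjugate_iff (x := P) hQu).2 hP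
    rwa [Matrix.star_eq_conjTranspose, Matrix.conjTranspose_eq_transpose_of_trivial, hQs] at h
  set U : Mat d := hN.isHermitian.eigenvectorUnitary.1 with hU
  have hUU : U * U.transpose = 1 := by
    simpa [Matrix.star_eq_conjTranspose, Matrix.conjTranspose_eq_transpose_of_trivial] using
      Unitary.coe_mul_star_self hN.isHermitian.eigenvectorUnitary
  have hUU' : U.transpose * U = 1 := mul_eq_one_comm.1 hUU
  -- With `Q = √W` and `U` an orthonormal eigenbasis of `Q P Q`, the factor `Q U` still squares to
  -- `W` and diagonalizes `P`.
  refine ⟨Q * U, hN.isHermitian.eigenvalues, ?_, ?_, hN.eigenvalues_pos⟩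
  · rw [Matrix.transpose_mul, hQs, Matrix.mul_assoc, ← Matrix.mul_assoc U, hUU, Matrix.one_mul, hQQ]
  · have h := hN.isHermitian.spectral_theorem
    rw [Unitary.conjStarAlgAut_apply] at h
    simp only [Matrix.star_eq_conjTranspose,
      Matrix.conjTranspose_eq_transpose_of_trivial] at h
    rw [Matrix.transpose_mul, hQs]
    calc U.transpose * Q * P * (Q * U) = U.transpose * (Q * P * Q) * U := by
          simp only [Matrix.mul_assoc]
      _ = _ := by
          refine (congrArg (fun Z => U.transpose * Z * U) h).trans ?_
          change U.transpose * (U * Matrix.diagonal hN.isHermitian.eigenvalues * U.transpose) * U = _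
          simp only [Matrix.mul_assoc]
          rw [hUU', ← Matrix.mul_assoc, hUU', Matrix.one_mul, Matrix.mul_one]

end LinearAlgebra

/-! ### Exponential moments of Gaussian vectors -/

section GaussianIntegrals

/-- Exponential moment of a square under a real Gaussian law. -/
lemma lintegral_exp_neg_mul_sq_gaussianReal_le (b : ℝ) (v : NNReal) {a : ℝ}
    (ha : 0 < 1 + 2 * a * v) (hab : 0 ≤ a * b ^ 2) :
    ∫⁻ y, ENNReal.ofReal (Real.exp (-a * y ^ 2)) ∂(gaussianReal b v)
      ≤ ENNReal.ofReal (1 / √(1 + 2 * a * v)) := by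
  by_cases hv : v = 0
  · subst hv
    rw [gaussianReal_zero_var, lintegral_dirac' _ (by fun_prop)]
    apply ENNReal.ofReal_le_ofReal
    simpa using hab
  have hv' : (0 : ℝ) < v := by positivity
  set D : ℝ := 1 + 2 * a * v with hD
  set β : ℝ := D / (2 * v) with hβ
  have hβ0 : 0 < β := by positivity
  rw [gaussianReal_of_var_ne_zero _ hv,
    lintegral_withDensity_eq_lintegral_mul _ (measurable_gaussianPDF b v) (by fun_prop)]
  have hpt : ∀ y, (gaussianPDF b v * fun y => ENNReal.ofReal (Real.exp (-a * y ^ 2))) y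
      ≤ ENNReal.ofReal ((√(2 * Real.pi * v))⁻¹ * Real.exp (-β * (y - b / D) ^ 2)) := by
    intro y
    rw [Pi.mul_apply, gaussianPDF, gaussianPDFReal, ← ENNReal.ofReal_mul (by positivity), mul_assoc,
      ← Real.exp_add]
    apply ENNReal.ofReal_le_ofReal
    gcongr
    -- Completing the square leaves the constant `-a b² / D`, which `hab` allows to be dropped. The
    -- bound thus serves `a > 0` with any mean (small ball) and `a < 0` with mean zero (upper
    -- tails).
    have h1 : -(y - b) ^ 2 / (2 * v) + -a * y ^ 2
        = -β * (y - b / D) ^ 2 - a * b ^ 2 / D := by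
      have hD0 : D ≠ 0 := ha.ne'
      have hv0 : (v : ℝ) ≠ 0 := hv'.ne'
      rw [hβ]
      field_simp
      rw [hD]
      ring
    have h2 : 0 ≤ a * b ^ 2 / D := by positivity
    linarith
  refine (lintegral_mono hpt).trans ?_
  have hint : Integrable (fun y : ℝ => Real.exp (-β * (y - b / D) ^ 2)) :=
    (integrable_exp_neg_mul_sq hβ0).comp_sub_right (b / D)
  rw [← ofReal_integral_eq_lintegral_ofReal (hint.const_mul _)
    (Filter.Eventually.of_forall fun y => by positivity), integral_const_mul,
    integral_sub_right_eq_self (fun y => Real.exp (-β * y ^ 2)), integral_gaussian]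
  apply ENNReal.ofReal_le_ofReal
  apply le_of_eq
  rw [← Real.sqrt_inv, ← Real.sqrt_mul (by positivity), one_div, ← Real.sqrt_inv]
  congr 1
  rw [hβ]
  field_simp

lemma one_div_sqrt_eq_exp {x : ℝ} (hx : 0 < x) : 1 / √x = Real.exp (-(Real.log x / 2)) := by
  rw [Real.exp_neg, one_div, Real.exp_half, Real.exp_log hx]

lemma neg_log_one_sub_le {z : ℝ} (hz : |z| ≤ 1 / 4) : -Real.log (1 - z) ≤ z + z ^ 2 := by
  have h := Real.abs_log_sub_add_sum_range_le (x := z) (by linarith) 2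
  simp only [Finset.sum_range_succ, Finset.sum_range_zero, zero_add, pow_one] at h
  norm_num at h
  have h3 := (abs_le.1 h).1
  have h4 : |z| ^ 3 / (1 - |z|) ≤ z ^ 2 / 2 := by
    rw [div_le_iff₀ (by linarith), ← sq_abs z]
    nlinarith [mul_nonneg (sq_nonneg |z|) (by linarith : 0 ≤ 1 / 4 - |z|), sq_nonneg |z|]
  linarith

/-- The moment is `(1 - 2c)^(-1/2)`; expand its logarithm to second order at `z = 2c`. The linear
term is the mean, the quadratic one the price of fluctuation. -/
lemma lintegral_exp_mul_sq_stdGaussianReal_le {c : ℝ} (hc : |c| ≤ 1 / 8) :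
    ∫⁻ y, ENNReal.ofReal (Real.exp (c * y ^ 2)) ∂(gaussianReal 0 1)
      ≤ ENNReal.ofReal (Real.exp (c + 2 * c ^ 2)) := by
  have hc' := abs_le.1 hc
  have h := lintegral_exp_neg_mul_sq_gaussianReal_le 0 1 (a := -c)
    (by rw [NNReal.coe_one]; linarith) (by simp)
  simp only [neg_neg, NNReal.coe_one] at h
  refine h.trans (ENNReal.ofReal_le_ofReal ?_)
  rw [one_div_sqrt_eq_exp (by linarith)]
  apply Real.exp_le_exp.2
  have h2 := neg_log_one_sub_le (z := 2 * c) (by rw [abs_mul, abs_two]; linarith)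
  have h3 : 1 + 2 * -c * 1 = 1 - 2 * c := by ring
  rw [h3]
  linarith

variable {d : ℕ}

/-- Characteristic functions agree. Any factor of `W` is allowed, not just the symmetric root, so
`R` can be the one that diagonalizes a second form. -/
lemma multivariateGaussian_eq_map_act {W R : Mat d} (hW : W.PosSemidef)
    (hR : R * R.transpose = W) :
    multivariateGaussian 0 W = (stdGaussian (State d)).map (act R) := by
  have : IsProbabilityMeasure ((stdGaussian (State d)).map (act R)) :=
    Measure.isProbabilityMeasure_map (by fun_prop)
  apply Measure.ext_of_charFun
  ext t
  rw [charFun_multivariateGaussian hW, charFun_apply, integral_map (by fun_prop)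
    (Measurable.aestronglyMeasurable (by fun_prop))]
  simp_rw [inner_act_left]
  rw [← charFun_apply, charFun_stdGaussian]
  have h : ‖act R.transpose t‖ ^ 2 = t.ofLp ⬝ᵥ W.mulVec t.ofLp := by
    rw [← inner_act_eq, ← hR, act_mul, inner_act_right, real_inner_self_eq_norm_sq]
  rw [← h]
  simp [neg_div]

lemma lintegral_stdGaussian_prod (f : Fin d → ℝ → ENNReal) (hf : ∀ i, Measurable (f i)) :
    ∫⁻ g, ∏ i, f i (g i) ∂(stdGaussian (State d)) = ∏ i, ∫⁻ y, f i y ∂(gaussianReal 0 1) := by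
  rw [← map_pi_eq_stdGaussian, lintegral_map (by fun_prop) (by fun_prop)]
  have h : iIndepFun (fun (i : Fin d) (g : Fin d → ℝ) => f i (g i))
      (Measure.pi fun _ => gaussianReal 0 1) :=
    iIndepFun_pi (fun i => (hf i).aemeasurable)
  refine (lintegral_prod_eq_prod_lintegral_of_indepFun Finset.univ _ h (by fun_prop)).trans ?_
  refine Finset.prod_congr rfl fun i _ => ?_
  rw [(measurePreserving_eval (fun _ : Fin d => gaussianReal 0 1) i).lintegral_comp (hf i)]

lemma lintegral_exp_norm_sq_stdGaussian_le :
    ∫⁻ g, ENNReal.ofReal (Real.exp (1 / 4 * ‖g‖ ^ 2)) ∂(stdGaussian (State d))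
      ≤ ENNReal.ofReal (Real.exp d) := by
  have h : ∀ g : State d, ENNReal.ofReal (Real.exp (1 / 4 * ‖g‖ ^ 2))
      = ∏ i, ENNReal.ofReal (Real.exp (1 / 4 * (g i) ^ 2)) := by
    intro g
    rw [EuclideanSpace.real_norm_sq_eq, Finset.mul_sum, Real.exp_sum,
      ENNReal.ofReal_prod_of_nonneg fun i _ => by positivity]
  simp_rw [h]
  rw [lintegral_stdGaussian_prod (fun _ y => ENNReal.ofReal (Real.exp (1 / 4 * y ^ 2)))
    (fun _ => by fun_prop)]
  have h1 := lintegral_exp_neg_mul_sq_gaussianReal_le 0 1 (a := -(1 / 4))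
    (by rw [NNReal.coe_one]; norm_num) (by simp)
  have h2 : ENNReal.ofReal (1 / √(1 + 2 * -(1 / 4) * ((1 : NNReal) : ℝ)))
      ≤ ENNReal.ofReal (Real.exp 1) := by
    apply ENNReal.ofReal_le_ofReal
    rw [NNReal.coe_one, one_div_sqrt_eq_exp (by norm_num)]
    apply Real.exp_le_exp.2
    have := Real.one_sub_inv_le_log_of_pos (x := 1 + 2 * -(1 / 4) * 1) (by norm_num)
    norm_num at this ⊢
    linarith
  simp only [neg_neg] at h1
  refine (Finset.prod_le_prod' fun i _ => h1.trans h2).trans ?_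
  rw [Finset.prod_const, Finset.card_univ, Fintype.card_fin,
    ← ENNReal.ofReal_pow (Real.exp_nonneg _), ← Real.exp_nat_mul, mul_one]

/-- Exponential moment of a centred quadratic form that is diagonal in the coordinates `R`. -/
lemma lintegral_exp_quadratic_multivariateGaussian_le {W P R : Mat d} {m : Fin d → ℝ} {s : ℝ}
    (hW : W.PosDef) (hR : R * R.transpose = W) (hm : R.transpose * P * R = Matrix.diagonal m)
    (hs : ∀ i, |s * (m i - 1)| ≤ 1 / 8) :
    ∫⁻ w, ENNReal.ofReal (Real.exp (s * (inner ℝ w (act P w) - inner ℝ w (act W⁻¹ w))))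
      ∂(multivariateGaussian 0 W)
      ≤ ENNReal.ofReal (Real.exp (∑ i, (s * (m i - 1) + 2 * (s * (m i - 1)) ^ 2))) := by
  rw [multivariateGaussian_eq_map_act hW.posSemidef hR, lintegral_map (by fun_prop) (by fun_prop)]
  have hRu : IsUnit R.det := by
    have h1 : IsUnit W.det := (Matrix.isUnit_iff_isUnit_det _).1 hW.isUnit
    rw [← hR, Matrix.det_mul] at h1
    exact isUnit_of_mul_isUnit_left h1
  have hRW : R.transpose * W⁻¹ * R = 1 := by
    rw [← hR, Matrix.mul_inv_rev, ← Matrix.mul_assoc,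
      Matrix.mul_nonsing_inv _ (by rwa [Matrix.det_transpose]), Matrix.one_mul,
      Matrix.nonsing_inv_mul _ hRu]
  have h : ∀ g : State d, ENNReal.ofReal (Real.exp (s * (inner ℝ (act R g) (act P (act R g))
      - inner ℝ (act R g) (act W⁻¹ (act R g)))))
      = ∏ i, ENNReal.ofReal (Real.exp (s * (m i - 1) * (g i) ^ 2)) := by
    intro g
    rw [← ENNReal.ofReal_prod_of_nonneg fun i _ => by positivity, ← Real.exp_sum]
    congr 2
    have h1 : ∀ X : Mat d, inner ℝ (act R g) (act X (act R g))
        = inner ℝ g (act (R.transpose * X * R) g) := by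
      intro X
      rw [inner_act_left, act_mul, act_mul]
    rw [h1, h1, hm, hRW, act_one, inner_eq_dotProduct, inner_eq_dotProduct,
      ← Finset.sum_sub_distrib, Finset.mul_sum]
    refine Finset.sum_congr rfl fun i _ => ?_
    have : act (Matrix.diagonal m) g i = m i * g i := by
      simp [act, Matrix.mulVec_diagonal]
    rw [this]; ring
  simp_rw [h]
  rw [lintegral_stdGaussian_prod (fun i y => ENNReal.ofReal (Real.exp (s * (m i - 1) * y ^ 2)))
    (fun _ => by fun_prop), Real.exp_sum, ENNReal.ofReal_prod_of_nonneg fun i _ => by positivity]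
  exact Finset.prod_le_prod' fun i _ => lintegral_exp_mul_sq_stdGaussianReal_le (hs i)

lemma map_inner_add_multivariateGaussian {W : Mat d} (hW : W.PosSemidef) (c : State d) (b : ℝ) :
    (multivariateGaussian 0 W).map (fun w => b + inner ℝ c w)
      = gaussianReal b (inner ℝ c (act W c)).toNNReal := by
  have h0 : (multivariateGaussian 0 W).map (fun w => inner ℝ c w)
      = gaussianReal 0 (inner ℝ c (act W c)).toNNReal := by
    have h := IsGaussian.map_eq_gaussianReal (μ := multivariateGaussian 0 W) (innerSL ℝ c)
    rw [(innerSL ℝ c).integral_comp_id_comm IsGaussian.integrable_id] at h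
    have h2 : Var[⇑(innerSL ℝ c); multivariateGaussian 0 W] = inner ℝ c (act W c) := by
      rw [inner_act_eq, ← covarianceBilin_multivariateGaussian (μ := 0) hW,
        covarianceBilin_self IsGaussian.memLp_two_id]
      rfl
    rw [h2, integral_id_multivariateGaussian, map_zero] at h
    exact h
  have : (fun w => b + inner ℝ c w) = (fun y => b + y) ∘ (fun w : State d => inner ℝ c w) := rfl
  rw [this, ← Measure.map_map (by fun_prop) (by fun_prop), h0, gaussianReal_map_const_add, zero_add]

lemma inner_act_self_nonneg {W : Mat d} (hW : W.PosSemidef) (c : State d) :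
    0 ≤ inner ℝ c (act W c) := by
  rw [inner_act_eq]
  simpa using hW.dotProduct_mulVec_nonneg c.ofLp

lemma lintegral_exp_inner_multivariateGaussian {W : Mat d} (hW : W.PosSemidef) (c : State d) :
    ∫⁻ w, ENNReal.ofReal (Real.exp (inner ℝ c w)) ∂(multivariateGaussian 0 W)
      = ENNReal.ofReal (Real.exp (inner ℝ c (act W c) / 2)) := by
  have h := map_inner_add_multivariateGaussian hW c 0
  simp only [zero_add] at h
  have h1 : ∫⁻ w, ENNReal.ofReal (Real.exp (inner ℝ c w)) ∂(multivariateGaussian 0 W)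
      = ∫⁻ y, ENNReal.ofReal (Real.exp y)
        ∂((multivariateGaussian 0 W).map (fun w => inner ℝ c w)) := by
    rw [lintegral_map (by fun_prop) (by fun_prop)]
  have h2 := integrable_exp_mul_gaussianReal (μ := 0) (v := (inner ℝ c (act W c)).toNNReal) 1
  simp only [one_mul] at h2
  have h3 := mgf_gaussianReal (p := gaussianReal 0 (inner ℝ c (act W c)).toNNReal) (X := id)
    Measure.map_id 1
  simp only [mgf, id, one_mul] at h3
  rw [h1, h, ← ofReal_integral_eq_lintegral_ofReal h2
    (Filter.Eventually.of_forall fun y => by positivity), h3,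
    Real.coe_toNNReal _ (inner_act_self_nonneg hW c)]
  simp

/-- Small-ball estimate: an affine image of a Gaussian vector is not concentrated near zero. -/
lemma lintegral_exp_neg_norm_sq_act_add_le {W D : Mat d} (hW : W.PosDef) {a : ℝ} (ha : 0 < a)
    (hWa : ∀ v, a * ‖v‖ ^ 2 ≤ inner ℝ v (act W v)) {l : ℝ} (hl : 0 ≤ l) (y : State d) :
    ∫⁻ w, ENNReal.ofReal (Real.exp (-(l * ‖act D (y + w)‖ ^ 2))) ∂(multivariateGaussian 0 W)
      ≤ ENNReal.ofReal (1 / √(1 + 2 * (l * (a * frobSq D)))) := by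
  rcases (frobSq_nonneg D).eq_or_lt with hF | hF
  · rw [← hF]
    calc _ ≤ ∫⁻ _, 1 ∂(multivariateGaussian 0 W) := by
          refine lintegral_mono fun w => ?_
          rw [← ENNReal.ofReal_one]
          apply ENNReal.ofReal_le_ofReal
          rw [Real.exp_le_one_iff, neg_nonpos]
          positivity
      _ ≤ _ := by simp
  set F := frobSq D
  set r : Fin d → State d := fun i => WithLp.toLp 2 (D i) with hr
  have hrv : ∀ i (v : State d), inner ℝ (r i) v = act D v i := fun i v => by
    rw [inner_eq_dotProduct, act_apply]
  have hrF : ∑ i, ‖r i‖ ^ 2 = F := by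
    simp only [EuclideanSpace.real_norm_sq_eq]; rfl
  -- The coordinates of `D w` are correlated, so the expectation does not factor over them. Jensen
  -- with these weights reduces to single coordinates, and rescaling by `1 / p i` gives all nonzero
  -- rows the same bound. A zero row has weight zero and contributes nothing.
  set p : Fin d → ℝ := fun i => ‖r i‖ ^ 2 / F with hp
  have hp0 : ∀ i, 0 ≤ p i := fun i => by positivity
  have hp1 : ∑ i, p i = 1 := by
    rw [hp, ← Finset.sum_div, hrF, div_self hF.ne']
  have hpt : ∀ w : State d, ENNReal.ofReal (Real.exp (-(l * ‖act D (y + w)‖ ^ 2)))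
      ≤ ∑ i, ENNReal.ofReal (p i) * ENNReal.ofReal
        (Real.exp (-(l / p i) * (inner ℝ (r i) y + inner ℝ (r i) w) ^ 2)) := by
    intro w
    simp_rw [← ENNReal.ofReal_mul (hp0 _)]
    rw [← ENNReal.ofReal_sum_of_nonneg fun i _ => mul_nonneg (hp0 i) (Real.exp_nonneg _)]
    apply ENNReal.ofReal_le_ofReal
    have hc := convexOn_exp.map_sum_le (t := Finset.univ) (w := p)
      (p := fun i => -(l / p i) * (inner ℝ (r i) y + inner ℝ (r i) w) ^ 2)
      (fun i _ => hp0 i) hp1 (fun _ _ => Set.mem_univ _)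
    simp only [smul_eq_mul] at hc
    refine le_trans (Real.exp_le_exp.2 ?_) hc
    rw [EuclideanSpace.real_norm_sq_eq, Finset.mul_sum, ← Finset.sum_neg_distrib]
    refine Finset.sum_le_sum fun i _ => ?_
    rw [← inner_add_right, hrv]
    rcases (hp0 i).eq_or_lt with h | h
    · rw [← h]; simp only [zero_mul]; rw [neg_nonpos]; positivity
    · apply le_of_eq; field_simp
  refine (lintegral_mono hpt).trans ?_
  rw [lintegral_finsetSum _ (fun i _ => by fun_prop)]
  have hB0 : 0 ≤ l * (a * F) := by positivity
  have hterm : ∀ i, ∫⁻ w, ENNReal.ofReal (p i) * ENNReal.ofReal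
        (Real.exp (-(l / p i) * (inner ℝ (r i) y + inner ℝ (r i) w) ^ 2))
          ∂(multivariateGaussian 0 W)
      ≤ ENNReal.ofReal (p i * (1 / √(1 + 2 * (l * (a * F))))) := by
    intro i
    rw [lintegral_const_mul _ (by fun_prop), ENNReal.ofReal_mul (hp0 i)]
    rcases (hp0 i).eq_or_lt with h | h
    · rw [← h]; simp
    gcongr
    have hv0 := inner_act_self_nonneg hW.posSemidef (r i)
    have h1 : ∫⁻ w, ENNReal.ofReal
        (Real.exp (-(l / p i) * (inner ℝ (r i) y + inner ℝ (r i) w) ^ 2))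
          ∂(multivariateGaussian 0 W)
        = ∫⁻ z, ENNReal.ofReal (Real.exp (-(l / p i) * z ^ 2))
          ∂((multivariateGaussian 0 W).map (fun w => inner ℝ (r i) y + inner ℝ (r i) w)) := by
      rw [lintegral_map (by fun_prop) (by fun_prop)]
    rw [h1, map_inner_add_multivariateGaussian hW.posSemidef]
    refine (lintegral_exp_neg_mul_sq_gaussianReal_le _ _ (by positivity) (by positivity)).trans ?_
    apply ENNReal.ofReal_le_ofReal
    rw [Real.coe_toNNReal _ hv0]
    gcongr 1 / √(1 + ?_)
    have h2 := hWa (r i)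
    have h3 : l * (a * F) = l / p i * (a * ‖r i‖ ^ 2) := by
      have : ‖r i‖ ^ 2 = p i * F := by rw [hp]; field_simp
      rw [this]; field_simp
    rw [h3, mul_assoc]
    gcongr
  refine (Finset.sum_le_sum fun i _ => hterm i).trans ?_
  rw [← ENNReal.ofReal_sum_of_nonneg fun i _ => by positivity, ← Finset.sum_mul, hp1, one_mul]

end GaussianIntegrals

/-! ### Exponential supermartingales along a trajectory -/

section Chernoff

variable {Ω : Type*} [mΩ : MeasurableSpace Ω] {μ : Measure Ω}

lemma measure_ge_le_exp_neg {Z : Ω → ℝ} (hZ : Measurable Z)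
    (h : ∫⁻ ω, ENNReal.ofReal (Real.exp (Z ω)) ∂μ ≤ 1) (u : ℝ) :
    μ {ω | u ≤ Z ω} ≤ ENNReal.ofReal (Real.exp (-u)) := by
  have h1 := mul_meas_ge_le_lintegral (μ := μ)
    (f := fun ω => ENNReal.ofReal (Real.exp (Z ω))) (by fun_prop) (ENNReal.ofReal (Real.exp u))
  have h2 : {ω | u ≤ Z ω}
      = {ω | ENNReal.ofReal (Real.exp u) ≤ ENNReal.ofReal (Real.exp (Z ω))} := by
    ext ω
    simp only [Set.mem_ofPred_eq]
    rw [ENNReal.ofReal_le_ofReal_iff (Real.exp_nonneg _), Real.exp_le_exp]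
  rw [h2]
  have h3 : ENNReal.ofReal (Real.exp (-u)) * ENNReal.ofReal (Real.exp u) = 1 := by
    rw [← ENNReal.ofReal_mul (Real.exp_nonneg _), ← Real.exp_add, neg_add_cancel, Real.exp_zero,
      ENNReal.ofReal_one]
  set S := μ {ω | ENNReal.ofReal (Real.exp u) ≤ ENNReal.ofReal (Real.exp (Z ω))}
  calc S = ENNReal.ofReal (Real.exp (-u)) * (ENNReal.ofReal (Real.exp u) * S) := by
        rw [← mul_assoc, h3, one_mul]
    _ ≤ ENNReal.ofReal (Real.exp (-u)) * 1 := by gcongr; exact h1.trans h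
    _ = _ := mul_one _

/-- A trajectory of `(A, W)` that is adapted to `F` and whose noise is independent of the past. -/
structure IsAdaptedLDS {d : ℕ} (μ : Measure Ω) (A W : Mat d) (T : ℕ)
    (F : ℕ → MeasurableSpace Ω) (x w : ℕ → Ω → State d) : Prop where
  le : ∀ t, F t ≤ mΩ
  mono : ∀ t, t < T → F t ≤ F (t + 1)
  measurable_state : ∀ t, t ≤ T → Measurable[F t] (x t)
  measurable_noise : ∀ t, t < T → Measurable[F (t + 1)] (w t)
  law : ∀ t, t < T → HasLaw (w t) (multivariateGaussian 0 W) μ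
  indep : ∀ t, t < T → Indep (F t) (MeasurableSpace.comap (w t) inferInstance) μ
  dynamics : ∀ t, t < T → ∀ ω, x (t + 1) ω = act A (x t ω) + w t ω

namespace IsAdaptedLDS

variable {d : ℕ} {A W : Mat d} {T : ℕ} {F : ℕ → MeasurableSpace Ω} {x w : ℕ → Ω → State d}

/-- This is the conditional expectation step, done by Fubini: `H` and `x t` depend on the past, `w
t` is independent of it, so the noise can be integrated out with the state held fixed. -/
lemma lintegral_mul_le [IsProbabilityMeasure μ] (h : IsAdaptedLDS μ A W T F x w) {t : ℕ}
    (ht : t < T)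
    {H : Ω → ENNReal} (hH : Measurable[F t] H) {f : State d → State d → ENNReal}
    (hf : Measurable (Function.uncurry f)) {c : ENNReal}
    (hc : ∀ y, ∫⁻ v, f y v ∂(multivariateGaussian 0 W) ≤ c) :
    ∫⁻ ω, H ω * f (x t ω) (w t ω) ∂μ ≤ c * ∫⁻ ω, H ω ∂μ := by
  have hx := h.measurable_state t ht.le
  have hpair : Measurable[F t] (fun ω => (H ω, x t ω)) := hH.prodMk hx
  have hpairΩ : Measurable (fun ω => (H ω, x t ω)) := hpair.mono (h.le t) le_rfl
  have hw : Measurable (w t) := (h.measurable_noise t ht).mono (h.le _) le_rfl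
  have hind : IndepFun (fun ω => (H ω, x t ω)) (w t) μ := by
    rw [IndepFun_iff_Indep]
    exact indep_of_indep_of_le_left (h.indep t ht) hpair.comap_le
  have hmap := (indepFun_iff_map_prod_eq_prod_map_map hpairΩ.aemeasurable hw.aemeasurable).1 hind
  have hG : Measurable (fun q : (ENNReal × State d) × State d => q.1.1 * f q.1.2 q.2) := by
    refine (measurable_fst.comp measurable_fst).mul ?_
    exact hf.comp ((measurable_snd.comp measurable_fst).prodMk measurable_snd)
  have : ∫⁻ ω, H ω * f (x t ω) (w t ω) ∂μ
      = ∫⁻ q, q.1.1 * f q.1.2 q.2 ∂(μ.map (fun ω => ((H ω, x t ω), w t ω))) := by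
    rw [lintegral_map hG (hpairΩ.prodMk hw)]
  have hp : IsProbabilityMeasure (μ.map (w t)) := Measure.isProbabilityMeasure_map hw.aemeasurable
  rw [this, hmap, lintegral_prod _ hG.aemeasurable, (h.law t ht).map_eq,
    lintegral_map (Measurable.lintegral_prod_right' hG) hpairΩ]
  calc _ ≤ ∫⁻ ω, c * H ω ∂μ := by
        refine lintegral_mono fun ω => ?_
        dsimp only
        have hm : Measurable (f (x t ω)) := hf.comp (measurable_const.prodMk measurable_id)
        rw [lintegral_const_mul _ hm, mul_comm c]
        gcongr
        exact hc _
    _ = _ := lintegral_const_mul _ (hH.mono (h.le t) le_rfl)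

lemma measurable_comp (h : IsAdaptedLDS μ A W T F x w) {n : ℕ} (hn : n < T)
    {f : State d → State d → ℝ} (hf : Measurable (Function.uncurry f)) :
    Measurable[F (n + 1)] (fun ω => f (x n ω) (w n ω)) :=
  hf.comp (((h.measurable_state n hn.le).mono (h.mono n hn) le_rfl).prodMk
    (h.measurable_noise n hn))

lemma measurable_sum (h : IsAdaptedLDS μ A W T F x w) {f : State d → State d → ℝ}
    (hf : Measurable (Function.uncurry f)) {n : ℕ} (hn : n ≤ T) :
    Measurable[F n] (fun ω => ∑ t ∈ Finset.range n, f (x t ω) (w t ω)) := by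
  induction n with
  | zero => simp only [Finset.range_zero, Finset.sum_empty]; exact measurable_const
  | succ n ih =>
    simp_rw [Finset.sum_range_succ]
    exact ((ih (by omega)).mono (h.mono n (by omega)) le_rfl).add (h.measurable_comp (by omega) hf)

/-- The exponential of the partial sum is a nonnegative supermartingale started at one: peel off the
last increment. Since the increment bound holds for every state `y`, no control of the state is
needed. -/
lemma lintegral_exp_sum_le_one [IsProbabilityMeasure μ] (h : IsAdaptedLDS μ A W T F x w)
    {f : State d → State d → ℝ} (hf : Measurable (Function.uncurry f))
    (h1 : ∀ y, ∫⁻ v, ENNReal.ofReal (Real.exp (f y v)) ∂(multivariateGaussian 0 W) ≤ 1)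
    {n : ℕ} (hn : n ≤ T) :
    ∫⁻ ω, ENNReal.ofReal (Real.exp (∑ t ∈ Finset.range n, f (x t ω) (w t ω))) ∂μ ≤ 1 := by
  induction n with
  | zero => simp
  | succ n ih =>
    simp_rw [Finset.sum_range_succ, Real.exp_add, ENNReal.ofReal_mul (Real.exp_nonneg _)]
    have hH : Measurable[F n] (fun ω => ENNReal.ofReal
        (Real.exp (∑ t ∈ Finset.range n, f (x t ω) (w t ω)))) :=
      (Real.measurable_exp.comp (h.measurable_sum hf (by omega))).ennreal_ofReal
    refine (h.lintegral_mul_le (by omega) hH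
      (f := fun y v => ENNReal.ofReal (Real.exp (f y v))) ?_ h1).trans ?_
    · exact (Real.measurable_exp.comp hf).ennreal_ofReal
    · rw [one_mul]; exact ih (by omega)

/-- Exponential supermartingale tail bound along a trajectory. -/
lemma measure_sum_ge_le [IsProbabilityMeasure μ] (h : IsAdaptedLDS μ A W T F x w)
    {f : State d → State d → ℝ} (hf : Measurable (Function.uncurry f))
    (h1 : ∀ y, ∫⁻ v, ENNReal.ofReal (Real.exp (f y v)) ∂(multivariateGaussian 0 W) ≤ 1)
    {n : ℕ} (hn : n ≤ T) (u : ℝ) :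
    μ {ω | u ≤ ∑ t ∈ Finset.range n, f (x t ω) (w t ω)} ≤ ENNReal.ofReal (Real.exp (-u)) :=
  measure_ge_le_exp_neg ((h.measurable_sum hf hn).mono (h.le n) le_rfl)
    (h.lintegral_exp_sum_le_one hf h1 hn) u

/-- The moment generating function of the state, propagated along the dynamics. -/
lemma lintegral_exp_inner_state_le [IsProbabilityMeasure μ] (h : IsAdaptedLDS μ A W T F x w)
    (hW : W.PosSemidef) {t : ℕ} (ht : t ≤ T) (v : State d) :
    ∫⁻ ω, ENNReal.ofReal (Real.exp (inner ℝ v (x t ω))) ∂μ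
      ≤ ENNReal.ofReal (Real.exp
          ((∑ s ∈ Finset.range t, inner ℝ v (act (A ^ s * W * (A ^ s).transpose) v)) / 2))
        * ∫⁻ ω, ENNReal.ofReal (Real.exp (inner ℝ (act (A ^ t).transpose v) (x 0 ω))) ∂μ := by
  -- One step back along the dynamics replaces `v` by `Aᵀ v`, so the direction has to vary.
  induction t generalizing v with
  | zero => simp [act_one]
  | succ t ih =>
    have hH : Measurable[F t] (fun ω => ENNReal.ofReal
        (Real.exp (inner ℝ (act A.transpose v) (x t ω)))) :=
      (Real.measurable_exp.comp ((measurable_const (a := act A.transpose v)).inner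
        (h.measurable_state t (by omega)))).ennreal_ofReal
    have hs := h.lintegral_mul_le (t := t) (by omega) hH
      (f := fun _ z => ENNReal.ofReal (Real.exp (inner ℝ v z))) (by fun_prop)
      (fun _ => (lintegral_exp_inner_multivariateGaussian hW v).le)
    have he : ∀ ω, ENNReal.ofReal (Real.exp (inner ℝ v (x (t + 1) ω)))
        = ENNReal.ofReal (Real.exp (inner ℝ (act A.transpose v) (x t ω)))
          * ENNReal.ofReal (Real.exp (inner ℝ v (w t ω))) := by
      intro ω
      rw [← ENNReal.ofReal_mul (Real.exp_nonneg _), ← Real.exp_add, h.dynamics t (by omega),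
        inner_add_right, inner_act_right]
    simp_rw [he]
    refine hs.trans ?_
    refine (mul_le_mul_right (ih (by omega) (act A.transpose v)) _).trans ?_
    rw [← mul_assoc, ← ENNReal.ofReal_mul (Real.exp_nonneg _), ← Real.exp_add, ← act_mul,
      ← Matrix.transpose_mul, ← pow_succ' A t]
    apply le_of_eq
    congr 3
    rw [Finset.sum_range_succ', ← add_div, add_comm]
    congr 2
    · refine Finset.sum_congr rfl fun s _ => ?_
      rw [← inner_act_right, ← act_mul, ← act_mul]
      congr 2
      rw [pow_succ' A s, Matrix.transpose_mul]
      simp only [Matrix.mul_assoc]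
    · simp

end IsAdaptedLDS

/-- Norm tail bound for a sub-Gaussian random vector. -/
lemma measure_norm_sq_gt_le [IsProbabilityMeasure μ] {d : ℕ} {X : Ω → State d} (hX : Measurable X)
    {S : ℝ} (hS : 0 < S)
    (h : ∀ v, ∫⁻ ω, ENNReal.ofReal (Real.exp (inner ℝ v (X ω))) ∂μ
      ≤ ENNReal.ofReal (Real.exp (S * ‖v‖ ^ 2 / 2))) (u : ℝ) :
    μ {ω | 4 * S * (d + u) ≤ ‖X ω‖ ^ 2} ≤ ENNReal.ofReal (Real.exp (-u)) := by
  set l := 1 / √(2 * S) with hl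
  have hl2 : l ^ 2 = 1 / (2 * S) := by
    rw [hl, div_pow, Real.sq_sqrt (by positivity), one_pow]
  have h1 : ∫⁻ ω, ENNReal.ofReal (Real.exp (‖X ω‖ ^ 2 / (4 * S))) ∂μ
      ≤ ENNReal.ofReal (Real.exp d) := by
    -- Linearize the square by an auxiliary Gaussian `g`. After exchanging the integrals, the
    -- hypothesis at direction `l • g` leaves `exp (‖g‖² / 4)`, which is integrable.
    have hz : ∀ z : State d, ENNReal.ofReal (Real.exp (‖z‖ ^ 2 / (4 * S)))
        = ∫⁻ g, ENNReal.ofReal (Real.exp (inner ℝ (l • z) g)) ∂(stdGaussian (State d)) := by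
      intro z
      rw [← multivariateGaussian_zero_one,
        lintegral_exp_inner_multivariateGaussian Matrix.PosSemidef.one, act_one,
        real_inner_self_eq_norm_sq, norm_smul, mul_pow, Real.norm_eq_abs, sq_abs, hl2]
      congr 2
      field_simp
      norm_num
    simp_rw [hz]
    rw [lintegral_lintegral_swap (by fun_prop)]
    refine le_trans (lintegral_mono fun g => ?_) lintegral_exp_norm_sq_stdGaussian_le
    have hsw : ∀ ω, inner ℝ (l • X ω) g = inner ℝ (l • g) (X ω) := fun ω => by
      rw [inner_smul_left, inner_smul_left, real_inner_comm]
    simp_rw [hsw]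
    refine (h (l • g)).trans (le_of_eq ?_)
    rw [norm_smul, mul_pow, Real.norm_eq_abs, sq_abs, hl2]
    congr 2
    field_simp
    ring
  have h2 := measure_ge_le_exp_neg (μ := μ) (Z := fun ω => ‖X ω‖ ^ 2 / (4 * S) - d)
    (by fun_prop) (by
      simp_rw [sub_eq_add_neg, Real.exp_add, ENNReal.ofReal_mul (Real.exp_nonneg _)]
      rw [lintegral_mul_const _ (by fun_prop)]
      refine (mul_le_mul_left h1 _).trans (le_of_eq ?_)
      rw [← ENNReal.ofReal_mul (Real.exp_nonneg _), ← Real.exp_add]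
      simp) u
  refine (measure_mono fun ω hω => ?_).trans h2
  simp only [Set.mem_ofPred_eq] at hω ⊢
  rw [le_sub_iff_add_le, le_div_iff₀ (by positivity)]
  linarith

end Chernoff

/-! ### Relative eigenvalues of two covariances -/

section Surrogate

variable {d : ℕ}

/-- Writing `log x = 2 log √x ≤ 2 (√x - 1)` gives the bound `(√x - 1)²` from below, and `(√x + 1)² ≤
2x + 2 ≤ 4c` converts it to `(x - 1)²`. -/
lemma sub_one_sub_log_ge {x c : ℝ} (hx : 0 < x) (hc : 1 ≤ c) (hxc : x ≤ c) :
    (x - 1) ^ 2 / (4 * c) ≤ x - 1 - Real.log x := by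
  have h0 : 0 < √x := Real.sqrt_pos.2 hx
  have h1 := Real.log_le_sub_one_of_pos h0
  rw [Real.log_sqrt hx.le] at h1
  have h2 := Real.sq_sqrt hx.le
  have h3 : (x - 1) ^ 2 / (4 * c) ≤ (√x - 1) ^ 2 := by
    have h4 : (x - 1) ^ 2 = (√x - 1) ^ 2 * (√x + 1) ^ 2 := by
      rw [← mul_pow]; congr 1; linarith
    rw [div_le_iff₀ (by linarith), h4]
    gcongr
    nlinarith [sq_nonneg (√x - 1)]
  nlinarith

lemma sub_one_sub_log_le {x : ℝ} (hx : |x - 1| ≤ 1 / 2) :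
    x - 1 - Real.log x ≤ 2 * (x - 1) ^ 2 := by
  rw [abs_le] at hx
  have h0 : 0 < x := by linarith
  have h1 := Real.one_sub_inv_le_log_of_pos h0
  have h2 : x - 1 - (1 - x⁻¹) = (x - 1) ^ 2 / x := by field_simp
  have h3 : (x - 1) ^ 2 / x ≤ 2 * (x - 1) ^ 2 := by
    rw [div_le_iff₀ h0]; nlinarith [sq_nonneg (x - 1)]
  linarith

lemma frobSq_diagonal (m : Fin d → ℝ) : frobSq (Matrix.diagonal m) = ∑ i, m i ^ 2 := by
  simp [frobSq, Matrix.diagonal_apply]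

lemma frobSq_congruence_diagonal_le {X : Mat d} {b : ℝ} (hb : 0 ≤ b)
    (hX : ∀ v, ‖act X v‖ ^ 2 ≤ b * ‖v‖ ^ 2) (m : Fin d → ℝ) :
    frobSq (X * (Matrix.diagonal m * X.transpose)) ≤ b ^ 2 * ∑ i, m i ^ 2 := by
  have h1 := frobSq_mul_le hX (Matrix.diagonal m)
  rw [← frobSq_transpose, Matrix.transpose_mul, Matrix.diagonal_transpose, frobSq_diagonal] at h1
  have h2 := frobSq_mul_le hX (Matrix.diagonal m * X.transpose)
  nlinarith [mul_le_mul_of_nonneg_left h1 hb]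

lemma posDef_of_forall_le {V : Mat d} (hV : V.IsSymm) {a : ℝ} (ha : 0 < a)
    (h : ∀ v, a * ‖v‖ ^ 2 ≤ inner ℝ v (act V v)) : V.PosDef := by
  refine Matrix.PosDef.of_dotProduct_mulVec_pos ?_ fun v hv => ?_
  · rwa [Matrix.IsHermitian, Matrix.conjTranspose_eq_transpose_of_trivial]
  · have h1 := h (WithLp.toLp 2 v)
    rw [inner_act_eq] at h1
    have h3 : (WithLp.toLp 2 v : State d) ≠ 0 := by simpa using hv
    have : 0 < ‖(WithLp.toLp 2 v : State d)‖ ^ 2 := by positivity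
    simp only [star_trivial]
    exact lt_of_lt_of_le (by positivity) h1

/-- Joint diagonalization of a covariance `W` and the inverse of a surrogate `V`, with the
control of the relative eigenvalues `m` that the classification argument uses. -/
lemma exists_relative_eigenvalues {W V : Mat d} (hW : W.PosDef) (hV : V.IsSymm) {a b B : ℝ}
    (ha : 0 < a) (hVa : ∀ v, a * ‖v‖ ^ 2 ≤ inner ℝ v (act V v))
    (hVb : ∀ v, inner ℝ v (act V v) ≤ b * ‖v‖ ^ 2)
    (hWB : ∀ v, inner ℝ v (act W v) ≤ B * ‖v‖ ^ 2) :
    ∃ (R : Mat d) (m : Fin d → ℝ), R * R.transpose = W ∧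
      R.transpose * V⁻¹ * R = Matrix.diagonal m ∧ (∀ i, 0 < m i) ∧ (∀ i, m i ≤ B / a) ∧
      frobSq (W - V) ≤ b ^ 2 * ∑ i, (m i - 1) ^ 2 ∧
      ∑ i, Real.log (m i) = Real.log W.det - Real.log V.det ∧
      ∀ e, (∀ v, |inner ℝ v (act (W - V) v)| ≤ e * ‖v‖ ^ 2) → ∀ i, |m i - 1| ≤ e / a := by
  have hVpd := posDef_of_forall_le hV ha hVa
  have hVu := isUnit_det_of_forall_le ha hVa
  obtain ⟨R, m, hR, hm, hm0⟩ := exists_simultaneous_diagonalization hW hVpd.inv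
  have hVis : V⁻¹.transpose = V⁻¹ := by rw [Matrix.transpose_nonsing_inv, hV.eq]
  -- Generalized eigenvectors: the forms of `W` and `V` at `z i` are `m i ^ 2` and `m i`, so `m i`
  -- is their Rayleigh quotient and inherits every comparison of `W` with `V`.
  set z : Fin d → State d := fun i => act (V⁻¹ * R) (EuclideanSpace.single i 1) with hz
  have hdiag : ∀ i, act (Matrix.diagonal m) (EuclideanSpace.single i (1 : ℝ))
      = m i • EuclideanSpace.single i (1 : ℝ) := by
    intro i
    ext j
    simp only [act, Matrix.mulVec_diagonal, PiLp.smul_apply, smul_eq_mul]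
    rcases eq_or_ne j i with rfl | hji
    · rfl
    · simp [hji]
  have hzW : ∀ i, inner ℝ (z i) (act W (z i)) = m i ^ 2 := by
    intro i
    rw [← hR, act_mul, inner_act_right, real_inner_self_eq_norm_sq, hz, ← act_mul,
      ← Matrix.mul_assoc, hm, hdiag, norm_smul]
    simp
  have hzV : ∀ i, inner ℝ (z i) (act V (z i)) = m i := by
    intro i
    simp only [hz]
    rw [← act_mul, ← Matrix.mul_assoc, Matrix.mul_nonsing_inv _ hVu, Matrix.one_mul,
      inner_act_left, ← act_mul, Matrix.transpose_mul, hVis, hm, hdiag, inner_smul_right]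
    simp
  have hza : ∀ i, ‖z i‖ ^ 2 ≤ m i / a := fun i => by
    rw [le_div_iff₀ ha, ← hzV i, mul_comm]; exact hVa _
  refine ⟨R, m, hR, hm, hm0, fun i => ?_, ?_, ?_, fun e he i => ?_⟩
  · have h1 := hWB (z i)
    rw [hzW] at h1
    have hz0 : 0 < ‖z i‖ ^ 2 := by
      rcases (sq_nonneg ‖z i‖).eq_or_lt with h | h
      · rw [← h, mul_zero] at h1
        have := hm0 i
        nlinarith
      · exact h
    have hB : 0 ≤ B := by
      by_contra hB
      nlinarith [hm0 i]
    have h2 : m i ^ 2 ≤ B * (m i / a) := h1.trans (mul_le_mul_of_nonneg_left (hza i) hB)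
    have h3 : B * (m i / a) = B / a * m i := by ring
    have := hm0 i
    nlinarith
  -- Rescaling `R` by `m^(-1/2)` normalizes `V` instead of `W`: `R' R'ᵀ = V` and `W - V = R' diag(m
  -- - 1) R'ᵀ`, with `‖R'‖² ≤ b` from the bound on `V`.
  · set D : Mat d := Matrix.diagonal fun i => (√(m i))⁻¹
    set R' := R * D with hR'
    have hD : D.transpose = D := Matrix.diagonal_transpose _
    have h1 : R'.transpose * (V⁻¹ * R') = 1 := by
      calc R'.transpose * (V⁻¹ * R') = D * (R.transpose * V⁻¹ * R) * D := by
            rw [hR', Matrix.transpose_mul, hD]; simp only [Matrix.mul_assoc]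
        _ = 1 := by
            rw [hm, Matrix.diagonal_mul_diagonal, Matrix.diagonal_mul_diagonal,
              ← Matrix.diagonal_one]
            congr 1
            ext i
            have h2 : 0 < √(m i) := Real.sqrt_pos.2 (hm0 i)
            have h3 := Real.sq_sqrt (hm0 i).le
            field_simp
            exact h3.symm
    have h2 : R' * R'.transpose = V := by
      have h3 := mul_eq_one_comm.1 h1
      calc R' * R'.transpose = V * (V⁻¹ * R' * R'.transpose) := by
            rw [Matrix.mul_assoc V⁻¹, ← Matrix.mul_assoc V, Matrix.mul_nonsing_inv _ hVu,
              Matrix.one_mul]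
        _ = V := by rw [h3, Matrix.mul_one]
    have h3 : W - V = R' * (Matrix.diagonal (fun i => m i - 1) * R'.transpose) := by
      have h4 : R' * (Matrix.diagonal m * R'.transpose) = W := by
        rw [← hR, hR', Matrix.transpose_mul, hD]
        have h5 : D * Matrix.diagonal m * D = 1 := by
          rw [Matrix.diagonal_mul_diagonal, Matrix.diagonal_mul_diagonal, ← Matrix.diagonal_one]
          congr 1
          ext i
          have h2 : 0 < √(m i) := Real.sqrt_pos.2 (hm0 i)
          have h3 := Real.sq_sqrt (hm0 i).le
          field_simp
          exact h3.symm
        calc _ = R * (D * Matrix.diagonal m * D) * R.transpose := by simp only [Matrix.mul_assoc]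
          _ = _ := by rw [h5, Matrix.mul_one]
      have h6 : Matrix.diagonal (fun i => m i - 1) = Matrix.diagonal m - 1 := by
        rw [← Matrix.diagonal_one, Matrix.diagonal_sub]
      rw [h6, Matrix.sub_mul, Matrix.mul_sub, h4, Matrix.one_mul, h2]
    have hn : ∀ v, ‖act R'.transpose v‖ ^ 2 ≤ b * ‖v‖ ^ 2 := by
      intro v
      rw [← real_inner_self_eq_norm_sq, ← inner_act_right, ← act_mul, h2]
      exact hVb v
    have hn' : ∀ v, ‖act R' v‖ ^ 2 ≤ b * ‖v‖ ^ 2 := fun v => by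
      have := norm_act_transpose_sq_le hn v
      rwa [Matrix.transpose_transpose] at this
    rcases isEmpty_or_nonempty (Fin d) with hd | ⟨⟨i0⟩⟩
    · simp [frobSq]
    have hb : 0 ≤ b := by
      have h := (hVa (EuclideanSpace.single i0 1)).trans (hVb _)
      simp at h
      linarith
    have h7 := frobSq_congruence_diagonal_le hb hn' (fun i => m i - 1)
    rw [← h3] at h7
    exact h7
  · have h1 := congrArg Matrix.det hm
    rw [Matrix.det_mul, Matrix.det_mul, Matrix.det_transpose, Matrix.det_diagonal,
      Matrix.det_nonsing_inv, Ring.inverse_eq_inv'] at h1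
    have h2 := congrArg Matrix.det hR
    rw [Matrix.det_mul, Matrix.det_transpose] at h2
    rw [← Real.log_prod (fun i _ => (hm0 i).ne'), ← h1,
      ← Real.log_div hW.det_pos.ne' hVpd.det_pos.ne', ← h2]
    congr 1
    ring
  -- The form of `W - V` at `z i` is `m i (m i - 1)`, while `‖z i‖² ≤ m i / a`; the common factor `m
  -- i` cancels.
  · have h1 := he (z i)
    rw [sub_act, inner_sub_right, hzW, hzV] at h1
    have h0 := hm0 i
    have hz0 : 0 < ‖z i‖ ^ 2 := by
      rcases (sq_nonneg ‖z i‖).eq_or_lt with h | h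
      · have h4 : z i = 0 := by simpa using h.symm
        have h5 := hzV i
        rw [h4, inner_zero_left] at h5
        linarith
      · exact h
    have he0 : 0 ≤ e := by
      by_contra hB
      have := (abs_nonneg _).trans h1
      nlinarith
    have h2 := h1.trans (mul_le_mul_of_nonneg_left (hza i) he0)
    have h3 : m i ^ 2 - m i = m i * (m i - 1) := by ring
    rw [h3, abs_mul, abs_of_pos h0] at h2
    have h4 : e * (m i / a) = m i * (e / a) := by ring
    rw [h4] at h2
    exact le_of_mul_le_mul_left h2 h0

lemma inner_act_inv_add {V : Mat d} (hV : V.IsSymm) (w y : State d) :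
    inner ℝ (w + y) (act V⁻¹ (w + y))
      = inner ℝ w (act V⁻¹ w) + 2 * inner ℝ w (act V⁻¹ y) + inner ℝ y (act V⁻¹ y) := by
  have hVis : V⁻¹.transpose = V⁻¹ := by rw [Matrix.transpose_nonsing_inv, hV.eq]
  have h : inner ℝ y (act V⁻¹ w) = inner ℝ w (act V⁻¹ y) := by
    rw [inner_act_right, hVis, real_inner_comm]
  rw [act_add, inner_add_left, inner_add_right, inner_add_right, h]
  ring

end Surrogate

/-! ### Loss comparison on one trajectory -/

section SingleTrajectory

variable {Ω : Type*} [mΩ : MeasurableSpace Ω] {μ : Measure Ω} {d : ℕ}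

lemma loss_eq {A A' V : Mat d} (hV : V.IsSymm) {T : ℕ} {y w : ℕ → State d}
    (h : ∀ t, t < T → y (t + 1) = act A (y t) + w t) :
    loss T y A' V = T * Real.log V.det + ∑ t ∈ Finset.range T,
      (inner ℝ (w t) (act V⁻¹ (w t)) + 2 * inner ℝ (w t) (act V⁻¹ (act (A - A') (y t)))
        + inner ℝ (act (A - A') (y t)) (act V⁻¹ (act (A - A') (y t)))) := by
  unfold loss
  congr 1
  refine Finset.sum_congr rfl fun t ht => ?_
  rw [← inner_act_inv_add hV, h t (Finset.mem_range.1 ht), sub_act]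
  congr 2 <;> abel_nf

lemma lintegral_exp_sub_le_one {α : Type*} [MeasurableSpace α] {ν : Measure α} {g : α → ℝ}
    (hg : Measurable g) {c : ℝ}
    (h : ∫⁻ z, ENNReal.ofReal (Real.exp (g z)) ∂ν ≤ ENNReal.ofReal (Real.exp c)) :
    ∫⁻ z, ENNReal.ofReal (Real.exp (g z - c)) ∂ν ≤ 1 := by
  simp_rw [sub_eq_add_neg, Real.exp_add, ENNReal.ofReal_mul (Real.exp_nonneg _)]
  rw [lintegral_mul_const _ (by fun_prop)]
  refine (mul_le_mul_left h _).trans (le_of_eq ?_)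
  rw [← ENNReal.ofReal_mul (Real.exp_nonneg _), ← Real.exp_add]
  simp

lemma act_smul_matrix (c : ℝ) (X : Mat d) (v : State d) : act (c • X) v = c • act X v := by
  simp [act_eq_clm]

/-- The left side is the log-moment of one cross-term increment given the past. Since `‖V⁻¹ y‖²` is
at most `(2/a) ⟪y, V⁻¹ y⟫`, it is a multiple of the very energies that appear in the loss gap, which
is what permits absorption. -/
lemma inner_act_cross_le {W Vl Vk Dl Dk : Mat d} {a b : ℝ} (ha : 0 < a) (hb : 0 < b)
    (hWb : ∀ v, inner ℝ v (act W v) ≤ b * ‖v‖ ^ 2)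
    (hka : ∀ v, a / 2 * ‖v‖ ^ 2 ≤ inner ℝ v (act Vk v))
    (hla : ∀ v, a / 2 * ‖v‖ ^ 2 ≤ inner ℝ v (act Vl v)) (c : ℝ) (y : State d) :
    inner ℝ (act (c • (Vl⁻¹ * Dl - Vk⁻¹ * Dk)) y)
        (act W (act (c • (Vl⁻¹ * Dl - Vk⁻¹ * Dk)) y)) / 2
      ≤ 2 * c ^ 2 * (b / a) * (inner ℝ (act Dl y) (act Vl⁻¹ (act Dl y))
        + inner ℝ (act Dk y) (act Vk⁻¹ (act Dk y))) := by
  have h4 := hWb (act (c • (Vl⁻¹ * Dl - Vk⁻¹ * Dk)) y)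
  have h5 := norm_act_inv_sq_le (by positivity : 0 < a / 2) hla (act Dl y)
  have h6 := norm_act_inv_sq_le (by positivity : 0 < a / 2) hka (act Dk y)
  have h7 : act (c • (Vl⁻¹ * Dl - Vk⁻¹ * Dk)) y
      = c • (act Vl⁻¹ (act Dl y) - act Vk⁻¹ (act Dk y)) := by
    rw [act_smul_matrix, sub_act, act_mul, act_mul]
  rw [h7] at h4 ⊢
  set p := act Vl⁻¹ (act Dl y)
  set q := act Vk⁻¹ (act Dk y)
  have h8 := parallelogram_law_with_norm ℝ p q
  have h9 : ‖p - q‖ ^ 2 ≤ 2 * (‖p‖ ^ 2 + ‖q‖ ^ 2) := by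
    nlinarith [mul_self_nonneg ‖p + q‖]
  rw [norm_smul, mul_pow, Real.norm_eq_abs, sq_abs] at h4
  set ql := inner ℝ (act Dl y) p
  set qk := inner ℝ (act Dk y) q
  have h10 : b * (c ^ 2 * ‖p - q‖ ^ 2) ≤ b * (c ^ 2 * (2 * (ql / (a / 2) + qk / (a / 2)))) := by
    gcongr
    linarith
  have h11 : b * (c ^ 2 * (2 * (ql / (a / 2) + qk / (a / 2)))) / 2
      = 2 * c ^ 2 * (b / a) * (ql + qk) := by
    field_simp
  linarith

namespace IsAdaptedLDS

variable {A W : Mat d} {T : ℕ} {F : ℕ → MeasurableSpace Ω} {x w : ℕ → Ω → State d}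

lemma measure_quadratic_ge_le [IsProbabilityMeasure μ] (h : IsAdaptedLDS μ A W T F x w)
    (hW : W.PosDef) {P R : Mat d} {m : Fin d → ℝ} {s : ℝ}
    (hR : R * R.transpose = W) (hm : R.transpose * P * R = Matrix.diagonal m)
    (hs : ∀ i, |s * (m i - 1)| ≤ 1 / 8) (u : ℝ) :
    μ {ω | u ≤ ∑ t ∈ Finset.range T,
      (s * (inner ℝ (w t ω) (act P (w t ω)) - inner ℝ (w t ω) (act W⁻¹ (w t ω)))
        - ∑ i, (s * (m i - 1) + 2 * (s * (m i - 1)) ^ 2))} ≤ ENNReal.ofReal (Real.exp (-u)) :=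
  h.measure_sum_ge_le (f := fun _ v => s * (inner ℝ v (act P v) - inner ℝ v (act W⁻¹ v))
        - ∑ i, (s * (m i - 1) + 2 * (s * (m i - 1)) ^ 2)) (by fun_prop)
    (fun _ => lintegral_exp_sub_le_one (by fun_prop)
      (lintegral_exp_quadratic_multivariateGaussian_le hW hR hm hs)) le_rfl u

lemma measure_linear_ge_le [IsProbabilityMeasure μ] (h : IsAdaptedLDS μ A W T F x w)
    (hW : W.PosSemidef) (G : Mat d) (u : ℝ) :
    μ {ω | u ≤ ∑ t ∈ Finset.range T, (inner ℝ (act G (x t ω)) (w t ω)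
      - inner ℝ (act G (x t ω)) (act W (act G (x t ω))) / 2)} ≤ ENNReal.ofReal (Real.exp (-u)) :=
  h.measure_sum_ge_le (f := fun y v => inner ℝ (act G y) v
      - inner ℝ (act G y) (act W (act G y)) / 2) (by fun_prop)
    (fun _ => lintegral_exp_sub_le_one (by fun_prop)
      (lintegral_exp_inner_multivariateGaussian hW _).le) le_rfl u

/-- With high probability the energy of the trajectory in the directions of `D` is of order
`T * ‖D‖_F ^ 2`. -/
lemma measure_energy_lt_le [IsProbabilityMeasure μ] (h : IsAdaptedLDS μ A W T F x w)
    (hW : W.PosDef) {a : ℝ} (ha : 0 < a) (hWa : ∀ v, a * ‖v‖ ^ 2 ≤ inner ℝ v (act W v))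
    (D : Mat d) (hT : 2 ≤ T) {u : ℝ} (hu : 8 * u ≤ T) :
    μ {ω | ∑ t ∈ Finset.range T, ‖act D (x t ω)‖ ^ 2 < a * frobSq D * (T / 8)}
      ≤ ENNReal.ofReal (Real.exp (-u)) := by
  rcases (frobSq_nonneg D).eq_or_lt with hF | hF
  · rw [← hF]
    have : {ω | ∑ t ∈ Finset.range T, ‖act D (x t ω)‖ ^ 2 < a * 0 * (T / 8)} = ∅ := by
      ext ω
      simp only [Set.mem_ofPred_eq, Set.mem_empty_iff_false, iff_false, not_lt]
      simp only [mul_zero, zero_mul]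
      positivity
    rw [this]; simp
  set Q := a * frobSq D with hQ
  have hQ0 : 0 < Q := by positivity
  have h3 : 1 + 2 * (1 / Q * Q) = 3 := by field_simp; norm_num
  have hlog : 1 ≤ Real.log 3 := by
    rw [Real.le_log_iff_exp_le (by norm_num)]
    exact Real.exp_one_lt_three.le
  -- With rate `1 / Q` each step has moment at most `3^(-1/2)`. The initial state is discarded,
  -- because only states with fresh noise are spread out; `T - 1 ≥ T / 2` states remain, and `(T -
  -- 1)/2 - T/8 ≥ T/8 ≥ u`.
  have h1 := h.measure_sum_ge_le
    (f := fun y v => -(1 / Q * ‖act D (act A y + v)‖ ^ 2) - -(Real.log 3 / 2)) (by fun_prop)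
    (fun y => lintegral_exp_sub_le_one (by fun_prop) (by
      have h2 := lintegral_exp_neg_norm_sq_act_add_le (D := D) hW ha hWa
        (l := 1 / Q) (by positivity) (act A y)
      rwa [← hQ, h3, one_div_sqrt_eq_exp (by norm_num)] at h2)) (n := T - 1) (by omega) u
  refine (measure_mono fun ω hω => ?_).trans h1
  simp only [Set.mem_ofPred_eq] at hω ⊢
  rw [Finset.sum_sub_distrib, Finset.sum_neg_distrib, ← Finset.mul_sum, Finset.sum_const,
    Finset.card_range, nsmul_eq_mul, Nat.cast_sub (by omega), Nat.cast_one]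
  have h4 : ∑ t ∈ Finset.range (T - 1), ‖act D (act A (x t ω) + w t ω)‖ ^ 2
      ≤ ∑ t ∈ Finset.range T, ‖act D (x t ω)‖ ^ 2 := by
    have h5 : T = (T - 1) + 1 := by omega
    rw [h5, Finset.sum_range_succ', Nat.add_sub_cancel]
    refine le_add_of_le_of_nonneg (le_of_eq ?_) (by positivity)
    refine Finset.sum_congr rfl fun t ht => ?_
    rw [h.dynamics t (by have := Finset.mem_range.1 ht; omega)]
  have h6 : 1 / Q * ∑ t ∈ Finset.range (T - 1), ‖act D (act A (x t ω) + w t ω)‖ ^ 2 ≤ T / 8 := by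
    rw [one_div, inv_mul_le_iff₀ hQ0]
    exact h4.trans hω.le
  have hT' : (2 : ℝ) ≤ T := by exact_mod_cast hT
  nlinarith

set_option maxHeartbeats 1000000 in
/-- Classification error for one trajectory and deterministic surrogate models. The surrogate
`(Ak, Vk)` is close to the truth `(A, W)`, while `(Al, Vl)` is separated from it. -/
lemma measure_loss_le_loss_le [IsProbabilityMeasure μ] (h : IsAdaptedLDS μ A W T F x w)
    (hW : W.PosDef) {a b : ℝ} (ha : 0 < a) (hab : a ≤ b)
    (hWa : ∀ v, a * ‖v‖ ^ 2 ≤ inner ℝ v (act W v)) (hWb : ∀ v, inner ℝ v (act W v) ≤ b * ‖v‖ ^ 2)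
    {Ak Vk Al Vl : Mat d} (hVk : Vk.IsSymm) (hVl : Vl.IsSymm)
    (hka : ∀ v, a / 2 * ‖v‖ ^ 2 ≤ inner ℝ v (act Vk v))
    (hkb : ∀ v, inner ℝ v (act Vk v) ≤ 3 / 2 * b * ‖v‖ ^ 2)
    (hla : ∀ v, a / 2 * ‖v‖ ^ 2 ≤ inner ℝ v (act Vl v))
    (hlb : ∀ v, inner ℝ v (act Vl v) ≤ 3 / 2 * b * ‖v‖ ^ 2)
    {e : ℝ} (he : ∀ v, |inner ℝ v (act (W - Vk) v)| ≤ e * ‖v‖ ^ 2) (hea : e ≤ a / 4)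
    {eA : ℝ} (heA : specNorm (A - Ak) ≤ eA) (hT : 2 ≤ T) {u : ℝ} (hu : 8 * u ≤ T) {r : ℝ}
    (hkey : T * (5 / 2 * (d * (e / (a / 2)) ^ 2) + 5 / 2 * (eA ^ 2 * r / a))
        + (64 * (b / a) + 4) * u
      < T * (frobSq (W - Vl) / (36 * (b / a) * b ^ 2) + frobSq (A - Al) / (16 * (b / a)))) :
    μ {ω | loss T (fun t => x t ω) Al Vl ≤ loss T (fun t => x t ω) Ak Vk ∧
        ∀ t < T, ‖x t ω‖ ^ 2 ≤ r} ≤ 4 * ENNReal.ofReal (Real.exp (-u)) := by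
  obtain ⟨R, m, hR, hm, hm0, hmB, hmF, hmlog, -⟩ :=
    exists_relative_eigenvalues hW hVl (by positivity : 0 < a / 2) hla hlb hWb
  obtain ⟨R', n, hR', hn, hn0, -, -, hnlog, hne⟩ :=
    exists_relative_eigenvalues hW hVk (by positivity : 0 < a / 2) hka hkb hWb
  have hb : 0 < b := ha.trans_le hab
  set κ := b / a with hκ
  have hκ1 : 1 ≤ κ := by rwa [hκ, one_le_div ha]
  have hκ0 : 0 < κ := by linarith
  have hmκ : ∀ i, m i ≤ 2 * κ := fun i => (hmB i).trans (le_of_eq (by rw [hκ]; field_simp))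
  have hne' := hne e he
  -- Since `m i` lies in `(0, 2κ]`, this rate keeps the chi-square bound valid. It makes the
  -- fluctuation cost `Sl / (16κ)`, half of the divergence lower bound `Sl / (8κ)`, and the
  -- cross-term variance `8 s² κ = s / 4` times the energies.
  set s : ℝ := 1 / (32 * κ) with hs
  have hs0 : 0 < s := by positivity
  have hms : ∀ i, |(-s) * (m i - 1)| ≤ 1 / 8 := by
    intro i
    rw [abs_mul, abs_neg, abs_of_pos hs0, hs, div_mul_eq_mul_div, one_mul,
      div_le_iff₀ (by positivity)]
    have h1 := hm0 i
    have h2 := hmκ i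
    rw [abs_le]; constructor <;> linarith
  have hea2 : e / (a / 2) ≤ 1 / 2 := by rw [div_le_iff₀ (by positivity)]; linarith
  have hns : ∀ i, |(1 / 4 : ℝ) * (n i - 1)| ≤ 1 / 8 := by
    intro i
    rw [abs_mul, abs_of_pos (by norm_num)]
    have := hne' i
    linarith
  set G : Mat d := (-(2 * s)) • (Vl⁻¹ * (A - Al) - Vk⁻¹ * (A - Ak)) with hG
  have e1 := h.measure_quadratic_ge_le hW hR hm hms u
  have e2 := h.measure_quadratic_ge_le hW hR' hn hns u
  have e3 := h.measure_linear_ge_le hW.posSemidef G u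
  have e4 := h.measure_energy_lt_le hW ha hWa (A - Al) hT hu
  have e5 : 4 * ENNReal.ofReal (Real.exp (-u)) = ENNReal.ofReal (Real.exp (-u))
      + ENNReal.ofReal (Real.exp (-u)) + ENNReal.ofReal (Real.exp (-u))
      + ENNReal.ofReal (Real.exp (-u)) := by ring
  rw [e5]
  refine le_trans (measure_mono ?_) ((measure_union_le _ _).trans (add_le_add
    ((measure_union_le _ _).trans (add_le_add ((measure_union_le _ _).trans
      (add_le_add e1 e2)) e3)) e4))
  -- Off the four exceptional events the inequalities are deterministic and contradict `hkey`.
  intro ω hω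
  by_contra hcon
  simp only [Set.mem_union, Set.mem_ofPred_eq, not_or, not_le, not_lt] at hcon hω
  obtain ⟨⟨⟨g1, g2⟩, g3⟩, g4⟩ := hcon
  obtain ⟨hloss, hr⟩ := hω
  rw [loss_eq hVl (w := fun t => w t ω) (fun t ht => h.dynamics t ht ω),
    loss_eq hVk (w := fun t => w t ω) (fun t ht => h.dynamics t ht ω)] at hloss
  set yl : ℕ → State d := fun t => act (A - Al) (x t ω) with hyl
  set yk : ℕ → State d := fun t => act (A - Ak) (x t ω) with hyk
  set ZW := ∑ t ∈ Finset.range T, inner ℝ (w t ω) (act W⁻¹ (w t ω))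
  set Zl := ∑ t ∈ Finset.range T, inner ℝ (w t ω) (act Vl⁻¹ (w t ω)) with hZl
  set Zk := ∑ t ∈ Finset.range T, inner ℝ (w t ω) (act Vk⁻¹ (w t ω)) with hZk
  set Ll := ∑ t ∈ Finset.range T, inner ℝ (w t ω) (act Vl⁻¹ (yl t)) with hLl
  set Lk := ∑ t ∈ Finset.range T, inner ℝ (w t ω) (act Vk⁻¹ (yk t)) with hLk
  set Ql := ∑ t ∈ Finset.range T, inner ℝ (yl t) (act Vl⁻¹ (yl t)) with hQl
  set Qk := ∑ t ∈ Finset.range T, inner ℝ (yk t) (act Vk⁻¹ (yk t)) with hQk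
  have hloss' : T * Real.log Vl.det + (Zl + 2 * Ll + Ql)
      ≤ T * Real.log Vk.det + (Zk + 2 * Lk + Qk) := by
    simpa only [hZl, hZk, hLl, hLk, hQl, hQk, Finset.sum_add_distrib, Finset.mul_sum] using hloss
  have hT' : (2 : ℝ) ≤ T := by exact_mod_cast hT
  have hsum : ∀ (c : ℝ) (q : Fin d → ℝ), ∑ i, (c * (q i - 1) + 2 * (c * (q i - 1)) ^ 2)
      = c * ∑ i, (q i - 1) + 2 * c ^ 2 * ∑ i, (q i - 1) ^ 2 := by
    intro c q
    rw [Finset.sum_add_distrib, Finset.mul_sum, Finset.mul_sum]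
    congr 1
    exact Finset.sum_congr rfl fun i _ => by ring
  rw [Finset.sum_sub_distrib, ← Finset.mul_sum, Finset.sum_sub_distrib, Finset.sum_const,
    Finset.card_range, nsmul_eq_mul, hsum] at g1 g2
  set Ml := ∑ i, (m i - 1)
  set Sl := ∑ i, (m i - 1) ^ 2
  set Mk := ∑ i, (n i - 1)
  set Sk := ∑ i, (n i - 1) ^ 2
  have hφl : Sl / (8 * κ) ≤ Ml - ∑ i, Real.log (m i) := by
    rw [← Finset.sum_sub_distrib, Finset.sum_div]
    refine Finset.sum_le_sum fun i _ => ?_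
    have := sub_one_sub_log_ge (hm0 i) (by linarith : 1 ≤ 2 * κ) (hmκ i)
    rwa [show 4 * (2 * κ) = 8 * κ by ring] at this
  have hφk : Mk - ∑ i, Real.log (n i) ≤ 2 * Sk := by
    rw [← Finset.sum_sub_distrib, Finset.mul_sum]
    exact Finset.sum_le_sum fun i _ => sub_one_sub_log_le ((hne' i).trans hea2)
  have hSk : Sk ≤ d * (e / (a / 2)) ^ 2 := by
    calc Sk ≤ ∑ _i : Fin d, (e / (a / 2)) ^ 2 := by
          refine Finset.sum_le_sum fun i _ => ?_
          rw [← sq_abs]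
          exact pow_le_pow_left₀ (abs_nonneg _) (hne' i) 2
      _ = _ := by simp
  have hFl : frobSq (W - Vl) / (36 * κ * b ^ 2) ≤ Sl / (16 * κ) := by
    rw [div_le_div_iff₀ (by positivity) (by positivity)]
    nlinarith [mul_le_mul_of_nonneg_right hmF (by positivity : 0 ≤ 16 * κ)]
  have hQl1 : frobSq (A - Al) / (12 * κ) * T ≤ Ql := by
    have h1 : (∑ t ∈ Finset.range T, ‖act (A - Al) (x t ω)‖ ^ 2) / (3 / 2 * b) ≤ Ql := by
      rw [Finset.sum_div]
      exact Finset.sum_le_sum fun t _ =>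
        le_inner_act_inv (by positivity : 0 < a / 2) (by positivity) hVl hla hlb _
    refine le_trans ?_ h1
    rw [le_div_iff₀ (by positivity)]
    refine le_trans (le_of_eq ?_) g4
    rw [hκ]
    field_simp
    ring
  have hQk1 : Qk ≤ T * (2 * (eA ^ 2 * r / a)) := by
    calc Qk ≤ ∑ _t ∈ Finset.range T, 2 * (eA ^ 2 * r / a) := by
          refine Finset.sum_le_sum fun t ht => ?_
          refine (inner_act_inv_le (by positivity : 0 < a / 2) hka _).trans ?_
          rw [div_le_iff₀ (by positivity)]
          have h1 : ‖yk t‖ ^ 2 ≤ eA ^ 2 * r := by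
            calc ‖yk t‖ ^ 2 ≤ (eA * ‖x t ω‖) ^ 2 := by
                  gcongr
                  exact (norm_act_le _ _).trans (by gcongr)
              _ = eA ^ 2 * ‖x t ω‖ ^ 2 := by ring
              _ ≤ _ := by gcongr; exact hr t (Finset.mem_range.1 ht)
          refine h1.trans (le_of_eq ?_)
          field_simp
      _ = _ := by simp
  -- The factor `2s` built into `G` is divided out again: the cross term costs `u / s` plus a
  -- quarter of both energies.
  have hcross : -(32 * κ * u) - 1 / 4 * (Ql + Qk) < 2 * (Ll - Lk) := by
    have h2 : ∑ t ∈ Finset.range T, inner ℝ (act G (x t ω)) (w t ω) = -(2 * s) * (Ll - Lk) := by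
      rw [hLl, hLk, ← Finset.sum_sub_distrib, Finset.mul_sum]
      refine Finset.sum_congr rfl fun t _ => ?_
      rw [hG, act_smul_matrix, sub_act, act_mul, act_mul, inner_smul_left, conj_trivial,
        real_inner_comm, inner_sub_right]
    have h3 : ∑ t ∈ Finset.range T, inner ℝ (act G (x t ω)) (act W (act G (x t ω))) / 2
        ≤ 8 * s ^ 2 * κ * (Ql + Qk) := by
      rw [hQl, hQk, ← Finset.sum_add_distrib, Finset.mul_sum]
      refine Finset.sum_le_sum fun t _ => ?_
      refine (inner_act_cross_le ha hb hWb hka hla (-(2 * s)) (x t ω)).trans (le_of_eq ?_)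
      rw [← hκ, show 2 * (-(2 * s)) ^ 2 * κ = 8 * s ^ 2 * κ by ring]
    rw [Finset.sum_sub_distrib, h2] at g3
    have h10 : 32 * κ * s = 1 := by rw [hs]; field_simp
    have h11 : 2 * s * (-(32 * κ * u) - 1 / 4 * (Ql + Qk)) < 2 * s * (2 * (Ll - Lk)) := by
      have h12 : 2 * s * (-(32 * κ * u) - 1 / 4 * (Ql + Qk))
          = -2 * (32 * κ * s) * u - 2 * (32 * κ * s) * (s / 4) * (Ql + Qk) := by
        linear_combination (s / 2) * (Ql + Qk) * h10
      have h13 : 8 * s ^ 2 * κ * (Ql + Qk) = (32 * κ * s) * (s / 4) * (Ql + Qk) := by ring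
      rw [h10] at h12 h13
      linarith
    exact lt_of_mul_lt_mul_left h11 (by positivity)
  have hZl1 : T * (Ml - Sl / (16 * κ)) - 32 * κ * u < Zl - ZW := by
    have h1 : 32 * κ * s = 1 := by rw [hs]; field_simp
    have h2 : s * (T * (Ml - Sl / (16 * κ)) - 32 * κ * u) < s * (Zl - ZW) := by
      have h3 : s * (T * (Ml - Sl / (16 * κ)) - 32 * κ * u)
          = T * (s * Ml - 2 * s ^ 2 * Sl) - u := by
        rw [hs]; field_simp; ring
      rw [h3]
      linarith
    exact lt_of_mul_lt_mul_left h2 hs0.le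
  have hZk1 : Zk - ZW < T * (Mk + Sk / 2) + 4 * u := by linarith
  have hF : 3 / 4 * (frobSq (A - Al) / (12 * κ)) = frobSq (A - Al) / (16 * κ) := by
    ring
  have hSl : Sl / (8 * κ) - Sl / (16 * κ) = Sl / (16 * κ) := by field_simp; norm_num
  have t1 := mul_le_mul_of_nonneg_left hφl (by positivity : (0 : ℝ) ≤ T)
  have t2 := mul_le_mul_of_nonneg_left hφk (by positivity : (0 : ℝ) ≤ T)
  have t3 := mul_le_mul_of_nonneg_left hSk (by positivity : (0 : ℝ) ≤ T)
  have t4 := mul_le_mul_of_nonneg_left hFl (by positivity : (0 : ℝ) ≤ T)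
  rw [hmlog] at t1
  rw [hnlog] at t2
  have t5 : T * (Sl / (8 * κ)) - T * (Sl / (16 * κ)) = T * (Sl / (16 * κ)) := by
    rw [← mul_sub, hSl]
  have t6 : T * (frobSq (A - Al) / (16 * κ)) = 3 / 4 * (frobSq (A - Al) / (12 * κ) * T) := by
    rw [← hF]; ring
  -- The constants of `hkey` arise here: `2 + 1/2` for `Sk`, `(1 + 1/4) * 2` for the energy of the
  -- right model, `32κ + 32κ + 4` for the three tails, and three quarters of `Ql` as signal.
  simp only [mul_sub, mul_add, add_mul] at *
  linarith

end IsAdaptedLDS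

end SingleTrajectory

/-! ### Finite-time and stationary covariances -/

section Covariance

variable {d : ℕ}

lemma abs_apply_le_specNorm (X : Mat d) (i j : Fin d) : |X i j| ≤ specNorm X := by
  have h1 : X i j = inner ℝ (EuclideanSpace.single i (1 : ℝ))
      (act X (EuclideanSpace.single j (1 : ℝ))) := by
    simp [inner_eq_dotProduct, act_apply]
  rw [h1]
  refine (abs_real_inner_le_norm _ _).trans ?_
  have := norm_act_le X (EuclideanSpace.single j (1 : ℝ))
  simpa using this

lemma specNorm_mul_le (X Y : Mat d) : specNorm (X * Y) ≤ specNorm X * specNorm Y := by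
  rw [specNorm, map_mul]
  exact norm_mul_le _ _

lemma specNorm_one_le : specNorm (1 : Mat d) ≤ 1 := by
  rw [specNorm, map_one]
  exact ContinuousLinearMap.norm_id_le

/-- Entrywise comparison with a geometric series of ratio `ρ²`. Without convergence `stationaryCov`
would be the default value of `tsum` and a bound on it would carry no information. -/
lemma hasSum_stationaryCov {A W : Mat d} {c ρ : ℝ} (hρ0 : 0 ≤ ρ) (hρ1 : ρ < 1)
    (h : ∀ t : ℕ, specNorm (A ^ t) ≤ c * ρ ^ t) :
    HasSum (fun t : ℕ => A ^ t * W * (A ^ t).transpose) (stationaryCov A W) := by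
  refine Summable.hasSum ?_
  refine Pi.summable.2 fun i => Pi.summable.2 fun j => ?_
  have hg : Summable (fun t : ℕ => c * specNorm W * c * (ρ ^ 2) ^ t) :=
    (summable_geometric_of_lt_one (by positivity) (by nlinarith)).mul_left _
  refine hg.of_norm_bounded fun t => ?_
  rw [Real.norm_eq_abs]
  refine (abs_apply_le_specNorm _ i j).trans ?_
  have h0 := specNorm_nonneg W
  have h1 := (specNorm_nonneg _).trans (h t)
  calc specNorm (A ^ t * W * (A ^ t).transpose)
      ≤ specNorm (A ^ t) * specNorm W * specNorm (A ^ t) := by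
        refine (specNorm_mul_le _ _).trans ?_
        rw [specNorm_transpose]
        exact mul_le_mul_of_nonneg_right (specNorm_mul_le _ _) (specNorm_nonneg _)
    _ ≤ (c * ρ ^ t) * specNorm W * (c * ρ ^ t) := by
        gcongr
        · exact specNorm_nonneg _
        · exact h t
        · exact h t
    _ = _ := by rw [← pow_mul, mul_comm 2 t, pow_mul]; ring

/-- The finite-time covariances are dominated by the stationary one. -/
lemma sum_inner_act_le_of_lambdaMax_stationaryCov {A W : Mat d} (hW : W.PosSemidef) {c ρ g : ℝ}
    (hρ0 : 0 ≤ ρ) (hρ1 : ρ < 1) (h : ∀ t : ℕ, specNorm (A ^ t) ≤ c * ρ ^ t)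
    (hg : lambdaMax (stationaryCov A W) ≤ g) (n : ℕ) (v : State d) :
    ∑ s ∈ Finset.range n, inner ℝ v (act (A ^ s * W * (A ^ s).transpose) v) ≤ g * ‖v‖ ^ 2 := by
  have hsum := hasSum_stationaryCov (W := W) hρ0 hρ1 h
  have hWs : W.transpose = W := by
    have := hW.isHermitian
    rwa [Matrix.IsHermitian, Matrix.conjTranspose_eq_transpose_of_trivial] at this
  have hsymm : (stationaryCov A W).IsSymm := by
    rw [Matrix.IsSymm, stationaryCov, Matrix.transpose_tsum]
    congr 1
    ext1 t
    rw [Matrix.transpose_mul, Matrix.transpose_mul, Matrix.transpose_transpose, hWs,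
      Matrix.mul_assoc]
  refine le_trans ?_ (inner_act_le_of_lambdaMax hsymm hg v)
  let φ : Mat d →+ ℝ :=
    { toFun := fun X => inner ℝ v (act X v)
      map_zero' := by simp [act_eq_clm]
      map_add' := fun X Y => by simp [act_eq_clm, inner_add_right] }
  have hφ : Continuous φ := by
    change Continuous fun X : Mat d => inner ℝ v (act X v)
    simp only [inner_eq_dotProduct, act_apply]
    fun_prop
  refine sum_le_hasSum _ (fun s _ => ?_) (hsum.map φ hφ)
  change 0 ≤ inner ℝ v (act (A ^ s * W * (A ^ s).transpose) v)
  rw [act_mul, act_mul, inner_act_right]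
  exact inner_act_self_nonneg hW _

end Covariance

/-! ### Sub-Gaussian states -/

section SubGaussian

variable {Ω : Type*} [mΩ : MeasurableSpace Ω] {μ : Measure Ω} {d : ℕ}

/-- A random vector whose moment generating function is dominated by that of `N(0, S I)`. -/
def IsSubGaussian (μ : Measure Ω) (S : ℝ) (X : Ω → State d) : Prop :=
  ∀ v, ∫⁻ ω, ENNReal.ofReal (Real.exp (inner ℝ v (X ω))) ∂μ
    ≤ ENNReal.ofReal (Real.exp (S * ‖v‖ ^ 2 / 2))

lemma IsSubGaussian.mono {S S' : ℝ} {X : Ω → State d} (h : IsSubGaussian μ S X) (hS : S ≤ S') :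
    IsSubGaussian μ S' X := fun v =>
  (h v).trans (ENNReal.ofReal_le_ofReal (Real.exp_le_exp.2 (by gcongr)))

lemma isSubGaussian_zero [IsProbabilityMeasure μ] {X : Ω → State d} (hX : ∀ ω, X ω = 0) :
    IsSubGaussian μ 0 X := fun v => by simp [hX]

/-- Variance proxies add: the noise accumulated up to time `t` contributes `g`, and the initial
state contributes its own proxy contracted by `‖A ^ t‖²`. -/
lemma IsAdaptedLDS.isSubGaussian [IsProbabilityMeasure μ] {A W : Mat d} {T : ℕ}
    {F : ℕ → MeasurableSpace Ω} {x w : ℕ → Ω → State d} (h : IsAdaptedLDS μ A W T F x w)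
    (hW : W.PosSemidef) {g S c : ℝ} {t : ℕ} (ht : t ≤ T) (hS : 0 ≤ S)
    (hx : IsSubGaussian μ S (x 0))
    (hg : ∀ v, ∑ s ∈ Finset.range t, inner ℝ v (act (A ^ s * W * (A ^ s).transpose) v)
      ≤ g * ‖v‖ ^ 2) (hc : specNorm (A ^ t) ^ 2 ≤ c) :
    IsSubGaussian μ (g + S * c) (x t) := by
  intro v
  refine (h.lintegral_exp_inner_state_le hW ht v).trans ?_
  refine (mul_le_mul_right (hx _) _).trans ?_
  rw [← ENNReal.ofReal_mul (Real.exp_nonneg _), ← Real.exp_add]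
  apply ENNReal.ofReal_le_ofReal
  apply Real.exp_le_exp.2
  have h1 : ‖act (A ^ t).transpose v‖ ^ 2 ≤ c * ‖v‖ ^ 2 := by
    calc ‖act (A ^ t).transpose v‖ ^ 2 ≤ (specNorm (A ^ t) * ‖v‖) ^ 2 := by
          gcongr
          have := norm_act_le (A ^ t).transpose v
          rwa [specNorm_transpose] at this
      _ = specNorm (A ^ t) ^ 2 * ‖v‖ ^ 2 := by ring
      _ ≤ _ := by gcongr
  have h2 := mul_le_mul_of_nonneg_left h1 hS
  have h3 := hg v
  linarith

end SubGaussian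

/-! ### Filtration of the concatenated noise, and state bounds in both cases -/

section Filtration

variable {Ω : Type*} {d K M : ℕ}

/-- Indices of the noise variables that precede time `t` of trajectory `m`. -/
def pastIndices (T : Fin M → ℕ) (m : Fin M) (t : ℕ) : Set (Σ m : Fin M, Fin (T m)) :=
  {p | p.1 < m ∨ (p.1 = m ∧ (p.2 : ℕ) < t)}

/-- The information generated by the noise before time `t` of trajectory `m`. -/
abbrev pastSigma (T : Fin M → ℕ) (w : Fin M → ℕ → Ω → State d) (m : Fin M) (t : ℕ) :
    MeasurableSpace Ω :=
  ⨆ p ∈ pastIndices T m t, MeasurableSpace.comap (w p.1 (p.2 : ℕ)) inferInstance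

lemma pastIndices_subset {T : Fin M → ℕ} {m : Fin M} {s t : ℕ} (hst : s ≤ t) :
    pastIndices T m s ⊆ pastIndices T m t := fun _ hp =>
  hp.imp id fun h => ⟨h.1, h.2.trans_le hst⟩

lemma pastIndices_subset_of_lt {T : Fin M → ℕ} {m m' : Fin M} (h : m < m') (t s : ℕ) :
    pastIndices T m t ⊆ pastIndices T m' s := fun _ hp =>
  Or.inl (hp.elim (fun h' => h'.trans h) fun h' => h'.1 ▸ h)

lemma pastSigma_mono {T : Fin M → ℕ} {w : Fin M → ℕ → Ω → State d} {m m' : Fin M} {s t : ℕ}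
    (h : pastIndices T m s ⊆ pastIndices T m' t) : pastSigma T w m s ≤ pastSigma T w m' t :=
  biSup_mono fun _ hp => h hp

variable {T : Fin M → ℕ} {w x : Fin M → ℕ → Ω → State d}

lemma measurable_noise_pastSigma {m : Fin M} {t : ℕ} (ht : t < T m) :
    Measurable[pastSigma T w m (t + 1)] (w m t) := by
  rw [measurable_iff_comap_le]
  exact le_iSup₂_of_le (⟨m, ⟨t, ht⟩⟩ : Σ m : Fin M, Fin (T m)) (Or.inr ⟨rfl, Nat.lt_succ_self t⟩)
    le_rfl

lemma Case0.measurable_init (h : Case0 x) (m : Fin M) :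
    Measurable[pastSigma T w m 0] (x m 0) := by
  have h1 : x m 0 = fun _ => 0 := funext fun ω => h m ω
  rw [h1]
  exact measurable_const

variable [mΩ : MeasurableSpace Ω] {μ : Measure Ω} {A W : Fin K → Mat d} {label : Fin M → Fin K}

lemma IsMixedLDS.measurable_state_pastSigma (h : IsMixedLDS μ A W T label w x) {m : Fin M}
    (h0 : Measurable[pastSigma T w m 0] (x m 0)) {t : ℕ} (ht : t ≤ T m) :
    Measurable[pastSigma T w m t] (x m t) := by
  induction t with
  | zero => exact h0
  | succ t ih =>
    have h1 : x m (t + 1) = fun ω => act (A (label m)) (x m t ω) + w m t ω :=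
      funext fun ω => h.dynamics m t (by omega) ω
    rw [h1]
    have h2 : Measurable[pastSigma T w m (t + 1)] (x m t) :=
      (ih (by omega)).mono (pastSigma_mono (pastIndices_subset t.le_succ)) le_rfl
    exact ((measurable_act _).comp h2).add (measurable_noise_pastSigma (by omega))

/-- The past is ordered lexicographically in (trajectory, time), so it contains all earlier
trajectories. This covers initial states inherited from a previous segment, and `w m t` is still
independent of it because its index is not among the past ones. -/
lemma IsMixedLDS.isAdaptedLDS (h : IsMixedLDS μ A W T label w x) {m : Fin M}
    (h0 : Measurable[pastSigma T w m 0] (x m 0)) :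
    IsAdaptedLDS μ (A (label m)) (W (label m)) (T m) (pastSigma T w m) (x m) (w m) where
  le t := iSup₂_le fun p _ => (h.noise_measurable p.1 p.2 p.2.2).comap_le
  mono t _ := pastSigma_mono (pastIndices_subset t.le_succ)
  measurable_state t ht := h.measurable_state_pastSigma h0 ht
  measurable_noise t ht := measurable_noise_pastSigma ht
  law t ht := h.noise_law m t ht
  indep t ht := by
    have h1 : Disjoint (pastIndices T m t) {(⟨m, ⟨t, ht⟩⟩ : Σ m : Fin M, Fin (T m))} := by
      rw [Set.disjoint_singleton_right]
      rintro (h2 | h2)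
      · exact lt_irrefl _ h2
      · exact lt_irrefl _ h2.2
    have h2 := indep_iSup_of_disjoint (fun p => (h.noise_measurable p.1 p.2 p.2.2).comap_le)
      ((iIndepFun_iff_iIndep _ _ _).1 h.noise_indep) h1
    simpa only [pastSigma, Set.mem_singleton_iff, iSup_iSup_eq_left] using h2
  dynamics t ht ω := h.dynamics m t ht ω

lemma Case1.measurable_init (hx : IsMixedLDS μ A W T label w x) (h : Case1 T x) (m : Fin M) :
    Measurable[pastSigma T w m 0] (x m 0) := by
  obtain ⟨m, hm⟩ := m
  induction m with
  | zero =>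
    have h1 : x ⟨0, hm⟩ 0 = fun _ => 0 := funext fun ω => h.1 ⟨0, hm⟩ rfl ω
    rw [h1]
    exact measurable_const
  | succ m ih =>
    have hm' : m < M := by omega
    have h1 : x ⟨m + 1, hm⟩ 0 = x ⟨m, hm'⟩ (T ⟨m, hm'⟩) :=
      funext fun ω => h.2 ⟨m, hm'⟩ ⟨m + 1, hm⟩ rfl ω
    rw [h1]
    exact (hx.measurable_state_pastSigma (ih hm') le_rfl).mono
      (pastSigma_mono (pastIndices_subset_of_lt (Fin.mk_lt_mk.2 m.lt_succ_self) _ _)) le_rfl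

variable {κA ρ Γmax Wmax Wmin κself ΔΓY ΔAW : ℝ}

lemma ModelAssumptions.specNorm_pow_le
    (h : ModelAssumptions A W κA ρ Γmax Wmax Wmin κself ΔΓY ΔAW) (k : Fin K) (t : ℕ) :
    specNorm (A k ^ t) ≤ κA * ρ ^ t := by
  rcases t.eq_zero_or_pos with rfl | ht
  · simpa using specNorm_one_le.trans h.one_le_κA
  · exact h.stable k t ht

lemma ModelAssumptions.specNorm_pow_sq_le
    (h : ModelAssumptions A W κA ρ Γmax Wmax Wmin κself ΔΓY ΔAW) (k : Fin K) (t : ℕ) :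
    specNorm (A k ^ t) ^ 2 ≤ κA ^ 2 := by
  have h1 := h.specNorm_pow_le k t
  have h2 : ρ ^ t ≤ 1 := pow_le_one₀ h.ρ_nonneg h.ρ_lt_one.le
  have h3 := h.one_le_κA
  gcongr
  · exact specNorm_nonneg _
  · nlinarith

lemma ModelAssumptions.sum_inner_act_le
    (h : ModelAssumptions A W κA ρ Γmax Wmax Wmin κself ΔΓY ΔAW) (k : Fin K) (n : ℕ) (v : State d) :
    ∑ s ∈ Finset.range n, inner ℝ v (act (A k ^ s * W k * (A k ^ s).transpose) v)
      ≤ Γmax * ‖v‖ ^ 2 :=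
  sum_inner_act_le_of_lambdaMax_stationaryCov (h.W_posDef k).posSemidef h.ρ_nonneg h.ρ_lt_one
    (h.specNorm_pow_le k) (h.cov_le k) n v

lemma ModelAssumptions.Γmax_pos
    (h : ModelAssumptions A W κA ρ Γmax Wmax Wmin κself ΔΓY ΔAW) : 0 < Γmax :=
  h.Wmin_pos.trans_le (h.Wmin_le_Wmax.trans h.Wmax_le_Γmax)

lemma Case0.isSubGaussian [IsProbabilityMeasure μ] (hx : IsMixedLDS μ A W T label w x)
    (hc : Case0 x) (h : ModelAssumptions A W κA ρ Γmax Wmax Wmin κself ΔΓY ΔAW)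
    {m : Fin M} {t : ℕ} (ht : t ≤ T m) : IsSubGaussian μ Γmax (x m t) := by
  have h1 := (hx.isAdaptedLDS (hc.measurable_init m)).isSubGaussian (t := t)
    (h.W_posDef (label m)).posSemidef ht
    le_rfl (isSubGaussian_zero (hc m)) (h.sum_inner_act_le (label m) t)
    (h.specNorm_pow_sq_le (label m) t)
  simpa using h1

/-- From `ρ ≤ exp (-(1 - ρ))`, the length condition forces `κA * ρ ^ n ≤ 1 / √2`. -/
lemma ModelAssumptions.specNorm_pow_sq_le_half
    (h : ModelAssumptions A W κA ρ Γmax Wmax Wmin κself ΔΓY ΔAW) (k : Fin K) {n : ℕ}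
    (hn : 1 / (1 - ρ) * Real.log (√2 * κA) ≤ n) :
    specNorm (A k ^ n) ^ 2 ≤ 1 / 2 := by
  have h1 := h.specNorm_pow_le k n
  have hρ := h.ρ_lt_one
  have hκ : 0 < κA := by linarith [h.one_le_κA]
  have h2 : ρ ^ n ≤ Real.exp (-((1 - ρ) * n)) := by
    calc ρ ^ n ≤ (Real.exp (-(1 - ρ))) ^ n := by
          apply pow_le_pow_left₀ h.ρ_nonneg
          have := Real.add_one_le_exp (-(1 - ρ))
          linarith
      _ = _ := by rw [← Real.exp_nat_mul]; congr 1; ring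
  have h3 : Real.log (√2 * κA) ≤ (1 - ρ) * n := by
    rw [one_div, inv_mul_le_iff₀ (by linarith)] at hn
    exact hn
  have h4 : Real.exp (-((1 - ρ) * n)) ≤ (√2 * κA)⁻¹ := by
    rw [← Real.exp_log (by positivity : 0 < (√2 * κA)⁻¹), Real.log_inv]
    exact Real.exp_le_exp.2 (by linarith)
  have h5 : specNorm (A k ^ n) ≤ (√2)⁻¹ := by
    calc specNorm (A k ^ n) ≤ κA * (√2 * κA)⁻¹ := h1.trans (by gcongr; exact h2.trans h4)
      _ = _ := by field_simp
  calc specNorm (A k ^ n) ^ 2 ≤ ((√2)⁻¹) ^ 2 := by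
        gcongr
        exact specNorm_nonneg _
    _ = 1 / 2 := by rw [inv_pow, Real.sq_sqrt (by norm_num)]; norm_num

/-- Passing through a segment maps the proxy `S` to at most `Γmax + S / 2`, whose fixed point is `2
Γmax`. Hence variance does not build up over the segments. -/
lemma Case1.isSubGaussian_init [IsProbabilityMeasure μ] (hx : IsMixedLDS μ A W T label w x)
    (hc : Case1 T x) (h : ModelAssumptions A W κA ρ Γmax Wmax Wmin κself ΔΓY ΔAW)
    (hT : ∀ m, 1 / (1 - ρ) * Real.log (√2 * κA) ≤ (T m : ℝ)) (m : Fin M) :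
    IsSubGaussian μ (2 * Γmax) (x m 0) := by
  have hΓ := h.Γmax_pos
  obtain ⟨m, hm⟩ := m
  induction m with
  | zero => exact (isSubGaussian_zero (hc.1 ⟨0, hm⟩ rfl)).mono (by positivity)
  | succ m ih =>
    have hm' : m < M := by omega
    have h1 : x ⟨m + 1, hm⟩ 0 = x ⟨m, hm'⟩ (T ⟨m, hm'⟩) :=
      funext fun ω => hc.2 ⟨m, hm'⟩ ⟨m + 1, hm⟩ rfl ω
    rw [h1]
    have h2 := (hx.isAdaptedLDS (Case1.measurable_init hx hc ⟨m, hm'⟩)).isSubGaussian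
      (h.W_posDef _).posSemidef le_rfl (by positivity) (ih hm') (h.sum_inner_act_le _ _)
      (h.specNorm_pow_sq_le_half _ (hT _))
    exact h2.mono (by linarith)

lemma Case1.isSubGaussian [IsProbabilityMeasure μ] (hx : IsMixedLDS μ A W T label w x)
    (hc : Case1 T x) (h : ModelAssumptions A W κA ρ Γmax Wmax Wmin κself ΔΓY ΔAW)
    (hT : ∀ m, 1 / (1 - ρ) * Real.log (√2 * κA) ≤ (T m : ℝ))
    {m : Fin M} {t : ℕ} (ht : t ≤ T m) : IsSubGaussian μ (3 * κA ^ 2 * Γmax) (x m t) := by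
  have hΓ := h.Γmax_pos
  have hκ := h.one_le_κA
  have h1 := (hx.isAdaptedLDS (Case1.measurable_init hx hc m)).isSubGaussian (t := t)
    (h.W_posDef _).posSemidef ht
    (by positivity) (hc.isSubGaussian_init hx h hT m) (h.sum_inner_act_le _ t)
    (h.specNorm_pow_sq_le _ t)
  exact h1.mono (by nlinarith [mul_nonneg hΓ.le (by nlinarith : 0 ≤ κA ^ 2 - 1)])

end Filtration

/-! ### Joint measurability of the loss, and freezing one independent variable -/

section Measurability

variable {d : ℕ}

lemma loss_congr {T : ℕ} {y y' : ℕ → State d} (h : ∀ t, t ≤ T → y t = y' t) (A W : Mat d) :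
    loss T y A W = loss T y' A W := by
  unfold loss
  congr 1
  refine Finset.sum_congr rfl fun t ht => ?_
  have ht' := Finset.mem_range.1 ht
  rw [h t ht'.le, h (t + 1) ht']

lemma measurable_loss {α : Type*} [MeasurableSpace α] {T : ℕ} {y : α → ℕ → State d}
    {A W : α → Mat d} (hA : ∀ i j, Measurable fun q => A q i j)
    (hdet : Measurable fun q => (W q).det) (hinv : ∀ i j, Measurable fun q => (W q)⁻¹ i j)
    (hy : ∀ t, Measurable fun q => y q t) :
    Measurable fun q => loss T (y q) (A q) (W q) := by
  have hy' : ∀ t i, Measurable fun q => y q t i := fun t i =>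
    (measurable_pi_apply i).comp ((WithLp.measurable_ofLp 2 _).comp (hy t))
  unfold loss
  simp only [inner_eq_dotProduct, act_apply, PiLp.sub_apply]
  have hr : ∀ t i, Measurable fun q => y q (t + 1) i - ∑ j, A q i j * y q t j := fun t i =>
    (hy' _ _).sub (Finset.measurable_sum _ fun j _ => (hA i j).mul (hy' _ _))
  exact (measurable_const.mul (Real.measurable_log.comp hdet)).add
    (Finset.measurable_sum _ fun t _ => Finset.measurable_sum _ fun i _ => (hr t i).mul
      (Finset.measurable_sum _ fun j _ => (hinv i j).mul (hr t j)))

lemma measurable_det_of_continuous {α : Type*} [TopologicalSpace α] [MeasurableSpace α]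
    [OpensMeasurableSpace α] {W : α → Mat d} (hW : Continuous W) :
    Measurable fun q => (W q).det := hW.matrix_det.measurable

lemma measurable_inv_apply_of_continuous {α : Type*} [TopologicalSpace α] [MeasurableSpace α]
    [OpensMeasurableSpace α] {W : α → Mat d} (hW : Continuous W) (i j : Fin d) :
    Measurable fun q => (W q)⁻¹ i j := by
  simp only [Matrix.inv_def, Ring.inverse_eq_inv', Matrix.smul_apply, smul_eq_mul]
  exact hW.matrix_det.measurable.inv.mul (hW.matrix_adjugate.matrix_elem i j).measurable

/-- Conditioning on one of two independent random elements. -/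
lemma measure_prodMk_mem_le_of_indepFun {Ω α β : Type*} [MeasurableSpace Ω] [MeasurableSpace α]
    [MeasurableSpace β] {μ : Measure Ω} [IsProbabilityMeasure μ] {X : Ω → α} {Y : Ω → β}
    (hX : Measurable X) (hY : Measurable Y) (h : IndepFun X Y μ) {B : Set (α × β)}
    (hB : MeasurableSet B) {c : ENNReal} (hc : ∀ᵐ ω ∂μ, μ {ω' | (X ω, Y ω') ∈ B} ≤ c) :
    μ {ω | (X ω, Y ω) ∈ B} ≤ c := by
  have h1 := (indepFun_iff_map_prod_eq_prod_map_map hX.aemeasurable hY.aemeasurable).1 h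
  have hp : IsProbabilityMeasure (μ.map Y) := Measure.isProbabilityMeasure_map hY.aemeasurable
  have h2 : μ {ω | (X ω, Y ω) ∈ B} = μ.map (fun ω => (X ω, Y ω)) B := by
    rw [Measure.map_apply (hX.prodMk hY) hB]; rfl
  rw [h2, h1, Measure.prod_apply hB, lintegral_map (measurable_measure_prodMk_left hB) hX]
  calc _ ≤ ∫⁻ _, c ∂μ := by
        refine lintegral_mono_ae (hc.mono fun ω hω => ?_)
        rw [Measure.map_apply hY (measurable_prodMk_left hB)]
        exact hω
    _ = c := by simp

end Measurability

/-! ### Bounds that pass from the true to the coarse models -/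

section SurrogateBounds

variable {d : ℕ}

lemma abs_inner_act_le_specNorm (X : Mat d) (v : State d) :
    |inner ℝ v (act X v)| ≤ specNorm X * ‖v‖ ^ 2 := by
  refine (abs_real_inner_le_norm _ _).trans ?_
  nlinarith [norm_act_le X v, norm_nonneg v]

lemma half_le_inner_act_of_specNorm_sub_le {V W : Mat d} {a e : ℝ}
    (hW : ∀ v, a * ‖v‖ ^ 2 ≤ inner ℝ v (act W v)) (h : specNorm (V - W) ≤ e) (he : e ≤ a / 2)
    (v : State d) : a / 2 * ‖v‖ ^ 2 ≤ inner ℝ v (act V v) := by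
  have h1 := abs_le.1 (abs_inner_act_le_specNorm (V - W) v)
  rw [sub_act, inner_sub_right] at h1
  have h2 : specNorm (V - W) * ‖v‖ ^ 2 ≤ a / 2 * ‖v‖ ^ 2 := by gcongr; exact h.trans he
  linarith [hW v, h1.1]

lemma inner_act_le_of_specNorm_sub_le {V W : Mat d} {b e : ℝ}
    (hW : ∀ v, inner ℝ v (act W v) ≤ b * ‖v‖ ^ 2) (h : specNorm (V - W) ≤ e) (he : e ≤ b / 2)
    (v : State d) : inner ℝ v (act V v) ≤ 3 / 2 * b * ‖v‖ ^ 2 := by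
  have h1 := abs_le.1 (abs_inner_act_le_specNorm (V - W) v)
  rw [sub_act, inner_sub_right] at h1
  have h2 : specNorm (V - W) * ‖v‖ ^ 2 ≤ b / 2 * ‖v‖ ^ 2 := by gcongr; exact h.trans he
  linarith [hW v, h1.2]

lemma specNorm_sub_comm (X Y : Mat d) : specNorm (X - Y) = specNorm (Y - X) := by
  simp only [specNorm, map_sub]
  exact norm_sub_rev _ _

lemma frobSq_sub_le_of_specNorm {X Y Z : Mat d} {e : ℝ} (h : specNorm (Z - Y) ≤ e) :
    frobSq (X - Y) ≤ 2 * frobSq (X - Z) + 2 * (d * e ^ 2) := by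
  refine (frobSq_sub_le X Y Z).trans ?_
  have h1 := frobSq_le_of_specNorm (Y - Z)
  have h2 : specNorm (Y - Z) ^ 2 ≤ e ^ 2 := by
    rw [specNorm_sub_comm]
    exact pow_le_pow_left₀ (specNorm_nonneg _) h 2
  have h3 : (d : ℝ) * specNorm (Y - Z) ^ 2 ≤ d * e ^ 2 := by gcongr
  linarith

end SurrogateBounds

/-! ### Numerical comparison of signal and error -/

section Parameters

set_option maxHeartbeats 1000000 in
/-- The signal of a separated model dominates all error terms of the classification loss. -/
lemma error_lt_signal {d T ι Δ a b Γ g εA εW FA FW : ℝ} (hd : 0 < d) (hι : 69 / 100 ≤ ι)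
    (hΔ : 0 < Δ) (ha : 0 < a) (hab : a ≤ b) (hbΓ : b ≤ Γ) (hg : 1 ≤ g)
    (hA : εA ^ 2 ≤ (1 / 160) ^ 2 * Δ ^ 2 * (a / (Γ * (b / a) * g ^ 2 * (d + ι))))
    (hW : d * (εW / a) ^ 2 ≤ (1 / 64) ^ 2 * (Δ ^ 2 / (b / a)))
    (hsep : Δ ^ 2 ≤ 2 * FA + 2 * (d * εA ^ 2) + (2 * FW + 2 * (d * εW ^ 2)) / b ^ 2)
    (hT0 : 0 < T)
    (hFA : 0 ≤ FA) (hT : 250000 * ((b / a) ^ 6 / Δ ^ 2) * ι ^ 2 ≤ T) :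
    T * (5 / 2 * (d * (εW / (a / 2)) ^ 2)
        + 5 / 2 * (εA ^ 2 * (4 * (3 * g ^ 2 * Γ) * (d + 2 * ι)) / a))
        + (64 * (b / a) + 4) * (6 * ι)
      < T * (FW / (36 * (b / a) * b ^ 2) + FA / (16 * (b / a))) := by
  have hb : 0 < b := ha.trans_le hab
  have hΓ : 0 < Γ := hb.trans_le hbΓ
  have hg0 : 0 < g := by linarith
  have hι0 : 0 < ι := by linarith
  have hκ1 : 1 ≤ b / a := by rwa [one_le_div ha]
  have hba : b = b / a * a := by field_simp
  set κ := b / a with hκ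
  have hκ0 : 0 < κ := by linarith
  set X := Δ ^ 2 / κ with hX
  have hX0 : 0 < X := by positivity
  have hΔX : Δ ^ 2 = X * κ := by rw [hX]; field_simp
  have e1 : d * (εW / (a / 2)) ^ 2 ≤ 1 / 1024 * X := by
    have : d * (εW / (a / 2)) ^ 2 = 4 * (d * (εW / a) ^ 2) := by field_simp; ring
    rw [this]; linarith
  -- The state bound grows like `g² Γ (d + ι)`, exactly the factor by which the admissible `εA²`
  -- shrinks.
  have e2 : εA ^ 2 * (4 * (3 * g ^ 2 * Γ) * (d + 2 * ι)) / a ≤ 24 / 25600 * X := by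
    calc εA ^ 2 * (4 * (3 * g ^ 2 * Γ) * (d + 2 * ι)) / a
        -- Only `d + 2ι ≤ 2 (d + ι)` is lost.
        ≤ ((1 / 160) ^ 2 * Δ ^ 2 * (a / (Γ * κ * g ^ 2 * (d + ι))))
          * (4 * (3 * g ^ 2 * Γ) * (2 * (d + ι))) / a := by gcongr; linarith
      _ = _ := by rw [hX]; field_simp; norm_num
  have e3 : (64 * κ + 4) * (6 * ι) ≤ T * (X / 384) := by
    have h1 : 250000 * (κ ^ 2 / Δ ^ 2) * (69 / 100 * ι) ≤ T := by
      refine le_trans ?_ hT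
      have h2 : κ ^ 2 ≤ κ ^ 6 := pow_le_pow_right₀ hκ1 (by norm_num)
      have h3 : 69 / 100 * ι ≤ ι ^ 2 := by nlinarith
      gcongr
    have h4 : 250000 * (κ ^ 2 / Δ ^ 2) * (69 / 100 * ι) * (X / 384) ≤ T * (X / 384) := by gcongr
    refine le_trans ?_ h4
    have h5 : 250000 * (κ ^ 2 / Δ ^ 2) * (69 / 100 * ι) * (X / 384)
        = 172500 / 384 * (κ * ι) := by rw [hX]; field_simp; norm_num
    rw [h5]
    linarith [mul_le_mul_of_nonneg_right hκ1 hι0.le]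
  have e4 : d * εA ^ 2 ≤ (1 / 160) ^ 2 * Δ ^ 2 := by
    calc d * εA ^ 2 ≤ d * ((1 / 160) ^ 2 * Δ ^ 2 * (a / (Γ * κ * g ^ 2 * (d + ι)))) := by gcongr
      _ = (1 / 160) ^ 2 * Δ ^ 2 * (d * a / (Γ * κ * g ^ 2 * (d + ι))) := by ring
      _ ≤ (1 / 160) ^ 2 * Δ ^ 2 * 1 := by
          gcongr
          rw [div_le_one (by positivity)]
          have h1 : a ≤ Γ * κ * g ^ 2 := by
            have : 1 ≤ κ * g ^ 2 := one_le_mul_of_one_le_of_one_le hκ1 (one_le_pow₀ hg)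
            calc a ≤ Γ := hab.trans hbΓ
              _ ≤ Γ * (κ * g ^ 2) := le_mul_of_one_le_right hΓ.le this
              _ = _ := by ring
          rw [mul_comm d a]
          exact mul_le_mul h1 (by linarith : d ≤ d + ι) hd.le (by positivity)
      _ = _ := mul_one _
  have e5 : d * εW ^ 2 / b ^ 2 ≤ (1 / 64) ^ 2 * Δ ^ 2 := by
    have h1 : d * εW ^ 2 / b ^ 2 = d * (εW / a) ^ 2 / κ ^ 2 := by
      rw [hκ]; field_simp
    rw [h1, div_le_iff₀ (by positivity)]
    refine hW.trans ?_
    have h2 : X ≤ Δ ^ 2 := by rw [hΔX]; nlinarith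
    have h3 : Δ ^ 2 ≤ Δ ^ 2 * κ ^ 2 := le_mul_of_one_le_right (by positivity) (one_le_pow₀ hκ1)
    linarith
  have e6 : 3 / 8 * Δ ^ 2 ≤ FA + FW / b ^ 2 := by
    have h1 : (2 * FW + 2 * (d * εW ^ 2)) / b ^ 2
        = 2 * (FW / b ^ 2) + 2 * (d * εW ^ 2 / b ^ 2) := by ring
    rw [h1] at hsep
    linarith [sq_nonneg Δ]
  have e7 : X / 96 ≤ FW / (36 * κ * b ^ 2) + FA / (16 * κ) := by
    have h1 : FW / (36 * κ * b ^ 2) = FW / b ^ 2 / (36 * κ) := by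
      rw [div_div]; congr 1; ring
    have h2 : FA / (36 * κ) ≤ FA / (16 * κ) := by gcongr; norm_num
    have h3 : X / 96 = (3 / 8 * Δ ^ 2) / (36 * κ) := by rw [hX]; field_simp; norm_num
    have h4 : (3 / 8 * Δ ^ 2) / (36 * κ) ≤ (FA + FW / b ^ 2) / (36 * κ) := by gcongr
    rw [add_div] at h4
    rw [h1, h3]
    linarith
  have e8 := mul_le_mul_of_nonneg_left e7 hT0.le
  have e9 : T * (5 / 2 * (d * (εW / (a / 2)) ^ 2)
        + 5 / 2 * (εA ^ 2 * (4 * (3 * g ^ 2 * Γ) * (d + 2 * ι)) / a))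
      ≤ T * (5 / 2 * (1 / 1024 * X) + 5 / 2 * (24 / 25600 * X)) := by gcongr
  have hTX : 0 < T * X := by positivity
  -- In units of `T * X` the errors total `5/2 * (1/1024 + 24/25600) + 1/384`, below the signal
  -- `1/96`.
  linarith

end Parameters

/-! ### Models and paths as functions of the two independent random elements -/

section ReadOff

variable {Ω : Type*} {d K M : ℕ} {T : Fin M → ℕ} {x : Fin M → ℕ → Ω → State d}

/-- The coarse models, read off from their entries. -/
def modelA (θ : Fin K → Fin d → Fin d → ℝ × ℝ) (k : Fin K) : Mat d :=
  Matrix.of fun i j => (θ k i j).1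

/-- The coarse covariances, read off from their entries. -/
def modelW (θ : Fin K → Fin d → Fin d → ℝ × ℝ) (k : Fin K) : Mat d :=
  Matrix.of fun i j => (θ k i j).2

/-- The trajectory `m`, read off from the collection of the classified trajectories. -/
def dataPath (T : Fin M → ℕ) {S : Finset (Fin M)} (m : {m : Fin M // m ∈ S})
    (y : (Σ m : {m : Fin M // m ∈ S}, Fin (T m.1 + 1)) → State d) (t : ℕ) : State d :=
  -- The default `0` is harmless: the loss of length `T m` reads only times up to `T m`.
  if h : t < T m.1 + 1 then y ⟨m, ⟨t, h⟩⟩ else 0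

lemma dataPath_trajectoryData {S : Finset (Fin M)} (m : {m : Fin M // m ∈ S}) (ω : Ω) {t : ℕ}
    (ht : t ≤ T m.1) : dataPath T m (trajectoryData T S x ω) t = x m.1 t ω := by
  simp [dataPath, trajectoryData, Nat.lt_succ_of_le ht]

lemma measurable_dataPath {S : Finset (Fin M)} (m : {m : Fin M // m ∈ S}) (t : ℕ) :
    Measurable fun y : (Σ m : {m : Fin M // m ∈ S}, Fin (T m.1 + 1)) → State d =>
      dataPath T m y t := by
  unfold dataPath
  split
  · exact measurable_pi_apply _
  · exact measurable_const

lemma continuous_modelW (k : Fin K) :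
    Continuous fun θ : Fin K → Fin d → Fin d → ℝ × ℝ => modelW θ k := by
  refine continuous_matrix fun i j => ?_
  simp only [modelW, Matrix.of_apply]
  fun_prop

lemma measurable_loss_model {S : Finset (Fin M)} (m : {m : Fin M // m ∈ S}) (k : Fin K) :
    Measurable fun q : (Fin K → Fin d → Fin d → ℝ × ℝ) ×
        ((Σ m : {m : Fin M // m ∈ S}, Fin (T m.1 + 1)) → State d) =>
      loss (T m.1) (dataPath T m q.2) (modelA q.1 k) (modelW q.1 k) := by
  refine measurable_loss (fun i j => ?_) ?_ (fun i j => ?_) fun t =>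
    (measurable_dataPath m t).comp measurable_snd
  · simp only [modelA, Matrix.of_apply]
    fun_prop
  · exact (measurable_det_of_continuous (continuous_modelW k)).comp measurable_fst
  · exact (measurable_inv_apply_of_continuous (continuous_modelW k) i j).comp measurable_fst

end ReadOff

/-! ### Misclassification probabilities and the union bound -/

section Classification

variable {Ω : Type*} [mΩ : MeasurableSpace Ω] {μ : Measure Ω} {d K M : ℕ}
  {A W : Fin K → Mat d} {T : Fin M → ℕ} {label : Fin M → Fin K} {w x : Fin M → ℕ → Ω → State d}
  {κA ρ Γmax Wmax Wmin κself ΔΓY ΔAW : ℝ}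

lemma ModelAssumptions.le_inner_act
    (h : ModelAssumptions A W κA ρ Γmax Wmax Wmin κself ΔΓY ΔAW) (k : Fin K) (v : State d) :
    Wmin * ‖v‖ ^ 2 ≤ inner ℝ v (act (W k) v) := by
  have hs : (W k).IsSymm := by
    have := (h.W_posDef k).isHermitian
    rwa [Matrix.IsHermitian, Matrix.conjTranspose_eq_transpose_of_trivial] at this
  exact le_inner_act_of_lambdaMin hs (h.Wmin_le k) v

lemma ModelAssumptions.inner_act_le
    (h : ModelAssumptions A W κA ρ Γmax Wmax Wmin κself ΔΓY ΔAW) (k : Fin K) (v : State d) :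
    inner ℝ v (act (W k) v) ≤ Wmax * ‖v‖ ^ 2 := by
  have hs : (W k).IsSymm := by
    have := (h.W_posDef k).isHermitian
    rwa [Matrix.IsHermitian, Matrix.conjTranspose_eq_transpose_of_trivial] at this
  exact inner_act_le_of_lambdaMax hs (h.le_Wmax k) v

lemma ModelAssumptions.separation_of_ne
    (h : ModelAssumptions A W κA ρ Γmax Wmax Wmin κself ΔΓY ΔAW) {k l : Fin K} (hkl : l ≠ k) :
    ΔAW ^ 2 ≤ frobSq (A k - A l) + frobSq (W k - W l) / Wmax ^ 2 := by
  rcases lt_or_gt_of_ne hkl with h1 | h1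
  · rw [frobSq_sub_comm (A k), frobSq_sub_comm (W k)]
    exact h.separation_model l k h1
  · exact h.separation_model k l h1

lemma measurable_trajectoryData (hx : ∀ m t, t ≤ T m → Measurable (x m t))
    (S : Finset (Fin M)) : Measurable (trajectoryData T S x) :=
  measurable_pi_lambda _ fun p => hx p.1.1 p.2 (Nat.le_of_lt_succ p.2.2)

/-- Misclassification probability of one trajectory as one wrong label. -/
lemma measure_misclassified_le [IsProbabilityMeasure μ]
    (hmod : ModelAssumptions A W κA ρ Γmax Wmax Wmin κself ΔΓY ΔAW)
    (hx : IsMixedLDS μ A W T label w x)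
    (hinit : ∀ m, Measurable[pastSigma T w m 0] (x m 0))
    {S : Finset (Fin M)} {Ahat What : Ω → Fin K → Mat d} {εA εW ι g : ℝ}
    (hmeas : Measurable (coarseModels Ahat What))
    (hind : IndepFun (coarseModels Ahat What) (trajectoryData T S x) μ)
    (hclose : ∀ᵐ ω ∂μ, ∀ k, (What ω k).IsSymm ∧
      specNorm (Ahat ω k - A k) ≤ εA ∧ specNorm (What ω k - W k) ≤ εW)
    (hd : 0 < d) (hι : 69 / 100 ≤ ι) (hg : 1 ≤ g)
    (hA : εA ≤ 1 / 160 * ΔAW * √(Wmin / (Γmax * (Wmax / Wmin) * g ^ 2 * (d + ι))))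
    (hW : εW / Wmin ≤ 1 / 64 * min 1 (ΔAW / √(Wmax / Wmin * d)))
    {m : Fin M} (hm : m ∈ S)
    (hT : 250000 * (κself ^ 2 + (Wmax / Wmin) ^ 6 / ΔAW ^ 2) * ι ^ 2 ≤ (T m : ℝ))
    {l : Fin K} (hl : l ≠ label m) :
    μ {ω | loss (T m) (fun t => x m t ω) (Ahat ω l) (What ω l)
          ≤ loss (T m) (fun t => x m t ω) (Ahat ω (label m)) (What ω (label m)) ∧
        ∀ t < T m, ‖x m t ω‖ ^ 2 ≤ 4 * (3 * g ^ 2 * Γmax) * (d + 2 * ι)}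
      ≤ 4 * ENNReal.ofReal (Real.exp (-(6 * ι))) := by
  set r := 4 * (3 * g ^ 2 * Γmax) * (d + 2 * ι)
  set k := label m
  have hlds := hx.isAdaptedLDS (hinit m)
  have hxm : ∀ m t, t ≤ T m → Measurable (x m t) := fun m t ht =>
    ((hx.isAdaptedLDS (hinit m)).measurable_state t ht).mono
      ((hx.isAdaptedLDS (hinit m)).le t) le_rfl
  -- The bad event as a measurable set of pairs (models, data), so that independence lets the models
  -- be fixed at any value satisfying the closeness bounds.
  set B : Set ((Fin K → Fin d → Fin d → ℝ × ℝ) ×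
      ((Σ m : {m : Fin M // m ∈ S}, Fin (T m.1 + 1)) → State d)) :=
    {q | loss (T m) (dataPath T ⟨m, hm⟩ q.2) (modelA q.1 l) (modelW q.1 l)
        ≤ loss (T m) (dataPath T ⟨m, hm⟩ q.2) (modelA q.1 k) (modelW q.1 k)} ∩
      ⋂ t ∈ Finset.range (T m), {q | ‖dataPath T ⟨m, hm⟩ q.2 t‖ ^ 2 ≤ r} with hB
  have hBm : MeasurableSet B := by
    refine (measurableSet_le (measurable_loss_model ⟨m, hm⟩ l)
      (measurable_loss_model ⟨m, hm⟩ k)).inter (Finset.measurableSet_biInter _ fun t _ => ?_)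
    exact measurableSet_le ((((measurable_dataPath ⟨m, hm⟩ t).comp measurable_snd).norm).pow_const 2)
      measurable_const
  have hBiff : ∀ ω ω', (coarseModels Ahat What ω, trajectoryData T S x ω') ∈ B ↔
      loss (T m) (fun t => x m t ω') (Ahat ω l) (What ω l)
          ≤ loss (T m) (fun t => x m t ω') (Ahat ω k) (What ω k) ∧
        ∀ t < T m, ‖x m t ω'‖ ^ 2 ≤ r := by
    intro ω ω'
    have h1 : ∀ t, t ≤ T m → dataPath T ⟨m, hm⟩ (trajectoryData T S x ω') t = x m t ω' :=
      fun t ht => dataPath_trajectoryData ⟨m, hm⟩ ω' ht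
    simp only [hB, Set.mem_inter_iff, Set.mem_ofPred_eq, Set.mem_iInter, Finset.mem_range]
    rw [loss_congr h1, loss_congr h1]
    refine and_congr Iff.rfl (forall_congr' fun t => forall_congr' fun ht => ?_)
    rw [h1 t ht.le]
  have hset : {ω | loss (T m) (fun t => x m t ω) (Ahat ω l) (What ω l)
          ≤ loss (T m) (fun t => x m t ω) (Ahat ω k) (What ω k) ∧
        ∀ t < T m, ‖x m t ω‖ ^ 2 ≤ r}
      = {ω | (coarseModels Ahat What ω, trajectoryData T S x ω) ∈ B} := by
    ext ω
    exact (hBiff ω ω).symm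
  rw [hset]
  refine measure_prodMk_mem_le_of_indepFun hmeas (measurable_trajectoryData hxm S) hind hBm
    (hclose.mono fun ω hω => ?_)
  simp only [hBiff]
  have ha := hmod.Wmin_pos
  have hab := hmod.Wmin_le_Wmax
  have hb := ha.trans_le hab
  have hΓ := hmod.Γmax_pos
  have hΔ := hmod.ΔAW_pos
  have hd' : (0 : ℝ) < d := by exact_mod_cast hd
  have hκ : 1 ≤ Wmax / Wmin := by rwa [one_le_div ha]
  have hι0 : 0 < ι := by linarith
  have hεA : 0 ≤ εA := (specNorm_nonneg _).trans (hω l).2.1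
  have hεW : 0 ≤ εW := (specNorm_nonneg _).trans (hω l).2.2
  have hεW1 : εW ≤ 1 / 64 * Wmin := by
    rw [div_le_iff₀ ha] at hW
    refine hW.trans ?_
    gcongr
    exact mul_le_of_le_one_right (by norm_num) (min_le_left _ _)
  have hA2 : εA ^ 2 ≤ (1 / 160) ^ 2 * ΔAW ^ 2
      * (Wmin / (Γmax * (Wmax / Wmin) * g ^ 2 * (d + ι))) := by
    calc εA ^ 2 ≤ (1 / 160 * ΔAW * √(Wmin / (Γmax * (Wmax / Wmin) * g ^ 2 * (d + ι)))) ^ 2 := by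
          gcongr
      _ = _ := by rw [mul_pow, mul_pow, Real.sq_sqrt (by positivity)]
  have hW2 : d * (εW / Wmin) ^ 2 ≤ (1 / 64) ^ 2 * (ΔAW ^ 2 / (Wmax / Wmin)) := by
    have h1 : εW / Wmin ≤ 1 / 64 * (ΔAW / √(Wmax / Wmin * d)) :=
      hW.trans (by gcongr; exact min_le_right _ _)
    calc d * (εW / Wmin) ^ 2 ≤ d * (1 / 64 * (ΔAW / √(Wmax / Wmin * d))) ^ 2 := by gcongr
      _ = _ := by
          rw [mul_pow, div_pow ΔAW, Real.sq_sqrt (by positivity)]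
          field_simp
  have hTsplit : 250000 * κself ^ 2 * ι ^ 2
      + 250000 * ((Wmax / Wmin) ^ 6 / ΔAW ^ 2) * ι ^ 2 ≤ T m := by
    refine le_trans (le_of_eq ?_) hT; ring
  have hT1 : 250000 * ((Wmax / Wmin) ^ 6 / ΔAW ^ 2) * ι ^ 2 ≤ T m :=
    le_trans (le_add_of_nonneg_left (by positivity)) hTsplit
  -- The `κself` part of the length condition enters through `κself ≥ 1`: it gives `T m ≥ 48 ι`, as
  -- the tail level `u = 6 ι` requires, and `T m ≥ 2`.
  have hT2 : 250000 * (69 / 100) * ι ≤ T m := by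
    refine le_trans ?_ (le_trans (le_add_of_nonneg_right (by positivity)) hTsplit)
    have h1 : 1 ≤ κself ^ 2 := one_le_pow₀ hmod.one_le_κself
    have h2 : 69 / 100 * ι ≤ ι ^ 2 := by nlinarith
    have h3 : ι ^ 2 ≤ κself ^ 2 * ι ^ 2 := le_mul_of_one_le_left (by positivity) h1
    linarith
  have hT3 : 2 ≤ T m := by
    have : (2 : ℝ) ≤ T m := by linarith
    exact_mod_cast this
  have hsep : ΔAW ^ 2 ≤ 2 * frobSq (A k - Ahat ω l) + 2 * (d * εA ^ 2)
      + (2 * frobSq (W k - What ω l) + 2 * (d * εW ^ 2)) / Wmax ^ 2 := by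
    refine (hmod.separation_of_ne hl).trans ?_
    have h1 := frobSq_sub_le_of_specNorm (X := A k) (hω l).2.1
    have h2 := frobSq_sub_le_of_specNorm (X := W k) (hω l).2.2
    gcongr
  have hclose' : ∀ v, |inner ℝ v (act (W k - What ω k) v)| ≤ εW * ‖v‖ ^ 2 := fun v => by
    refine (abs_inner_act_le_specNorm _ v).trans ?_
    rw [specNorm_sub_comm]
    gcongr
    exact (hω k).2.2
  exact hlds.measure_loss_le_loss_le (hmod.W_posDef k) ha hab (hmod.le_inner_act k)
    (hmod.inner_act_le k) (hω k).1 (hω l).1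
    (half_le_inner_act_of_specNorm_sub_le (hmod.le_inner_act k) (hω k).2.2 (by linarith))
    (inner_act_le_of_specNorm_sub_le (hmod.inner_act_le k) (hω k).2.2 (by linarith))
    (half_le_inner_act_of_specNorm_sub_le (hmod.le_inner_act l) (hω l).2.2 (by linarith))
    (inner_act_le_of_specNorm_sub_le (hmod.inner_act_le l) (hω l).2.2 (by linarith))
    hclose' (by linarith) (by rw [specNorm_sub_comm]; exact (hω k).2.1) hT3
    (by linarith)
    (error_lt_signal hd' hι hΔ ha hab hmod.Wmax_le_Γmax hg hA2 hW2 hsep (by linarith)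
      (frobSq_nonneg _) hT1)

/-- Union bound over times, trajectories and labels. -/
lemma measure_correctly_classified_ge [IsProbabilityMeasure μ]
    (hmod : ModelAssumptions A W κA ρ Γmax Wmax Wmin κself ΔΓY ΔAW)
    (hx : IsMixedLDS μ A W T label w x)
    (hinit : ∀ m, Measurable[pastSigma T w m 0] (x m 0))
    {S : Finset (Fin M)} {Ahat What : Ω → Fin K → Mat d} {εA εW δ g : ℝ}
    (hlabel : Function.Surjective label)
    (hmeas : Measurable (coarseModels Ahat What))
    (hind : IndepFun (coarseModels Ahat What) (trajectoryData T S x) μ)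
    (hclose : ∀ᵐ ω ∂μ, ∀ k, (What ω k).IsSymm ∧
      specNorm (Ahat ω k - A k) ≤ εA ∧ specNorm (What ω k - W k) ≤ εW)
    (hδ0 : 0 < δ) (hδ1 : δ < 1) (hg : 1 ≤ g)
    (hsub : ∀ m t, t ≤ T m → IsSubGaussian μ (3 * g ^ 2 * Γmax) (x m t))
    (hA : εA ≤ 1 / 160 * ΔAW * √(Wmin / (Γmax * (Wmax / Wmin) * g ^ 2
      * (d + Real.log (((∑ m, T m : ℕ) : ℝ) / δ)))))
    (hW : εW / Wmin ≤ 1 / 64 * min 1 (ΔAW / √(Wmax / Wmin * d)))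
    (hT : ∀ m ∈ S, 250000 * (κself ^ 2 + (Wmax / Wmin) ^ 6 / ΔAW ^ 2)
      * Real.log (((∑ m, T m : ℕ) : ℝ) / δ) ^ 2 ≤ (T m : ℝ)) :
    ENNReal.ofReal (1 - δ) ≤ μ {ω | ∀ m ∈ S, ∀ k,
      IsInferredLabel (T m) (fun t => x m t ω) (Ahat ω) (What ω) k → k = label m} := by
  rcases Nat.lt_or_ge K 2 with hK | hK
  · have hsing : Subsingleton (Fin K) := Fin.subsingleton_iff_le_one.2 (by omega)
    have : {ω | ∀ m ∈ S, ∀ k, IsInferredLabel (T m) (fun t => x m t ω) (Ahat ω) (What ω) k →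
        k = label m} = Set.univ := by
      ext ω
      simp only [Set.mem_ofPred_eq, Set.mem_univ, iff_true]
      exact fun m _ k _ => Subsingleton.elim _ _
    rw [this, measure_univ]
    exact ENNReal.ofReal_le_one.2 (by linarith)
  -- In dimension zero two distinct labels could not be separated.
  have hd : 0 < d := by
    rcases d.eq_zero_or_pos with rfl | h
    · have h1 := hmod.separation_model ⟨0, by omega⟩ ⟨1, by omega⟩ (by simp)
      have h2 := hmod.ΔAW_pos
      simp only [frobSq, Finset.univ_eq_empty, Finset.sum_empty, zero_div, add_zero] at h1
      nlinarith
    · exact h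
  set N := ∑ m, T m with hN
  set ι := Real.log ((N : ℝ) / δ) with hι
  -- Every label occurs, so the number of labels is at most the total length `N`. This keeps the
  -- union bound polynomial in `N`, and `K ≥ 2` gives `N ≥ 2`, hence `ι ≥ log 2`.
  have hKM : K ≤ M := by
    simpa using Fintype.card_le_of_surjective label hlabel
  have hMN : M ≤ N := by
    calc M = ∑ _m : Fin M, 1 := by simp
      _ ≤ N := Finset.sum_le_sum fun m _ => hx.length_pos m
  have hN2 : (2 : ℝ) ≤ N := by exact_mod_cast hK.trans (hKM.trans hMN)
  have hN0 : (0 : ℝ) < N := by linarith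
  have hexp : Real.exp (-ι) = δ / N := by
    rw [Real.exp_neg, hι, Real.exp_log (by positivity), inv_div]
  have hι1 : 69 / 100 ≤ ι := by
    have h1 : Real.log 2 ≤ ι := Real.log_le_log (by norm_num) (by
      rw [le_div_iff₀ hδ0]; nlinarith)
    have := Real.log_two_gt_d9
    linarith
  set r := 4 * (3 * g ^ 2 * Γmax) * (d + 2 * ι) with hr
  -- Tail levels `2 ι` per state and `6 ι` per pair give `N (δ/N)²` and at most `4 N² (δ/N)⁶`, each
  -- at most `δ / 2`.
  set E1 : Set Ω := ⋃ p : Σ m : Fin M, Fin (T m), {ω | r ≤ ‖x p.1 p.2 ω‖ ^ 2}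
  set E2 : Set Ω := ⋃ q : Fin M × Fin K, {ω | (q.1 ∈ S ∧ q.2 ≠ label q.1) ∧
    loss (T q.1) (fun t => x q.1 t ω) (Ahat ω q.2) (What ω q.2)
      ≤ loss (T q.1) (fun t => x q.1 t ω) (Ahat ω (label q.1)) (What ω (label q.1)) ∧
    ∀ t < T q.1, ‖x q.1 t ω‖ ^ 2 ≤ r}
  have hΓ := hmod.Γmax_pos
  have hE1 : μ E1 ≤ ENNReal.ofReal (δ / 2) := by
    refine (measure_iUnion_le _).trans ?_
    rw [tsum_fintype]
    calc _ ≤ ∑ _p : Σ m : Fin M, Fin (T m), ENNReal.ofReal (Real.exp (-(2 * ι))) := by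
          refine Finset.sum_le_sum fun p _ => ?_
          have hlds := hx.isAdaptedLDS (hinit p.1)
          exact measure_norm_sq_gt_le
            ((hlds.measurable_state p.2 p.2.2.le).mono (hlds.le _) le_rfl) (by positivity)
            (hsub p.1 p.2 p.2.2.le) (2 * ι)
      _ = ENNReal.ofReal (N * Real.exp (-(2 * ι))) := by
          rw [Finset.sum_const, Finset.card_univ, Fintype.card_sigma, nsmul_eq_mul,
            ENNReal.ofReal_mul (by positivity), ENNReal.ofReal_natCast]
          simp [hN]
      _ ≤ _ := by
          apply ENNReal.ofReal_le_ofReal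
          have h1 : Real.exp (-(2 * ι)) = (δ / N) ^ 2 := by
            rw [← hexp, ← Real.exp_nat_mul]; congr 1; push_cast; ring
          rw [h1]
          have h2 : (N : ℝ) * (δ / N) ^ 2 = δ ^ 2 / N := by field_simp
          rw [h2, div_le_div_iff₀ hN0 (by norm_num)]
          nlinarith
  have hE2 : μ E2 ≤ ENNReal.ofReal (δ / 2) := by
    refine (measure_iUnion_le _).trans ?_
    rw [tsum_fintype]
    calc _ ≤ ∑ _q : Fin M × Fin K, 4 * ENNReal.ofReal (Real.exp (-(6 * ι))) := by
          refine Finset.sum_le_sum fun q _ => ?_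
          by_cases hq : q.1 ∈ S ∧ q.2 ≠ label q.1
          · refine (measure_mono fun ω hω => hω.2).trans ?_
            exact measure_misclassified_le hmod hx hinit hmeas hind hclose hd hι1 hg hA hW hq.1
              (hT q.1 hq.1) hq.2
          · simp [hq]
      _ = ENNReal.ofReal (M * K * (4 * Real.exp (-(6 * ι)))) := by
          rw [Finset.sum_const, Finset.card_univ, Fintype.card_prod, nsmul_eq_mul,
            ENNReal.ofReal_mul (by positivity), ENNReal.ofReal_mul (by positivity),
            ENNReal.ofReal_mul (by positivity), ENNReal.ofReal_natCast, ENNReal.ofReal_natCast]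
          simp
      _ ≤ _ := by
          apply ENNReal.ofReal_le_ofReal
          have h1 : Real.exp (-(6 * ι)) = (δ / N) ^ 6 := by
            rw [← hexp, ← Real.exp_nat_mul]; congr 1; push_cast; ring
          have h2 : (M : ℝ) ≤ N := by exact_mod_cast hMN
          have h3 : (K : ℝ) ≤ N := by exact_mod_cast hKM.trans hMN
          rw [h1]
          calc (M : ℝ) * K * (4 * (δ / N) ^ 6) ≤ N * N * (4 * (δ / N) ^ 6) := by gcongr
            _ = 4 * δ ^ 6 / N ^ 4 := by field_simp
            _ ≤ 4 * δ / 2 ^ 4 := by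
                gcongr
                calc δ ^ 6 = δ * δ ^ 5 := by ring
                  _ ≤ δ * 1 := by gcongr; exact pow_le_one₀ hδ0.le hδ1.le
                  _ = δ := mul_one δ
            _ ≤ δ / 2 := by linarith
  set G : Set Ω := {ω | ∀ m ∈ S, ∀ k,
      IsInferredLabel (T m) (fun t => x m t ω) (Ahat ω) (What ω) k → k = label m}
  -- A covering with subadditivity needs no measurability of the success event. Any minimizer other
  -- than the true label ties or beats it, so ties also land in `E2` and uniqueness is included.
  have hcover : Set.univ ⊆ G ∪ (E1 ∪ E2) := by
    intro ω _
    by_cases h1 : ω ∈ E1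
    · exact Or.inr (Or.inl h1)
    by_cases h2 : ω ∈ E2
    · exact Or.inr (Or.inr h2)
    refine Or.inl fun m hm k hk => ?_
    by_contra hne
    refine h2 (Set.mem_iUnion.2 ⟨(m, k), ⟨hm, hne⟩, hk (label m), fun t ht => ?_⟩)
    by_contra hlt
    exact h1 (Set.mem_iUnion.2 ⟨⟨m, ⟨t, ht⟩⟩, (not_le.1 hlt).le⟩)
  have h1 : 1 ≤ μ G + ENNReal.ofReal δ := by
    calc 1 = μ Set.univ := measure_univ.symm
      _ ≤ μ (G ∪ (E1 ∪ E2)) := measure_mono hcover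
      _ ≤ μ G + (μ E1 + μ E2) :=
          (measure_union_le _ _).trans (add_le_add le_rfl (measure_union_le _ _))
      _ ≤ μ G + (ENNReal.ofReal (δ / 2) + ENNReal.ofReal (δ / 2)) := by gcongr
      _ = _ := by rw [← ENNReal.ofReal_add (by positivity) (by positivity), add_halves]
  rw [ENNReal.ofReal_sub _ hδ0.le, ENNReal.ofReal_one]
  exact tsub_le_iff_right.2 h1

end Classification

end MixedLDS

end

/-! ### The main theorem: both cases through one parameter `g` -/

theorem theorem6 :
    ∃ c₁ c₂ C₃ : ℝ, 0 < c₁ ∧ 0 < c₂ ∧ 0 < C₃ ∧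
    ∀ {Ω : Type*} [MeasurableSpace Ω] (μ : Measure Ω) [IsProbabilityMeasure μ]
      (d K M : ℕ) (A W : Fin K → MixedLDS.Mat d)
      (κA ρ Γmax Wmax Wmin κself ΔΓY ΔAW : ℝ)
      (T : Fin M → ℕ) (label : Fin M → Fin K) (w x : Fin M → ℕ → Ω → MixedLDS.State d)
      (Mclass : Finset (Fin M)) (pmin : ℝ)
      (Ahat What : Ω → Fin K → MixedLDS.Mat d) (εA εW δ κcross ι : ℝ),
      MixedLDS.ModelAssumptions A W κA ρ Γmax Wmax Wmin κself ΔΓY ΔAW →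
      MixedLDS.IsMixedLDS μ A W T label w x →
      0 < pmin →
      (∀ k, pmin ≤ ((Mclass.filter (fun m => label m = k)).card : ℝ) / (Mclass.card : ℝ)) →
      Measurable (MixedLDS.coarseModels Ahat What) →
      IndepFun (MixedLDS.coarseModels Ahat What) (MixedLDS.trajectoryData T Mclass x) μ →
      (∀ᵐ ω ∂μ, ∀ k, (What ω k).IsSymm ∧
        MixedLDS.specNorm (Ahat ω k - A k) ≤ εA ∧ MixedLDS.specNorm (What ω k - W k) ≤ εW) →
      0 < δ → δ < 1 →
      κcross = Wmax / Wmin →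
      ι = Real.log (((∑ m, T m : ℕ) : ℝ) / δ) →
      ((MixedLDS.Case0 x ∧
          εA ≤ c₁ * ΔAW * Real.sqrt (Wmin / (Γmax * κcross * (d + ι))) ∧
          εW / Wmin ≤ c₂ * min 1 (ΔAW / Real.sqrt (κcross * d)) ∧
          ∀ m ∈ Mclass, C₃ * (κself ^ 2 + κcross ^ 6 / ΔAW ^ 2) * ι ^ 2 ≤ (T m : ℝ)) ∨
        (MixedLDS.Case1 T x ∧
          (∀ m, 1 / (1 - ρ) * Real.log (Real.sqrt 2 * κA) ≤ (T m : ℝ)) ∧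
          εA ≤ c₁ * ΔAW * Real.sqrt (Wmin / (Γmax * κcross * κA ^ 2 * (d + ι))) ∧
          εW / Wmin ≤ c₂ * min 1 (ΔAW / Real.sqrt (κcross * d)) ∧
          ∀ m ∈ Mclass, C₃ * (κself ^ 2 + κcross ^ 6 / ΔAW ^ 2) * ι ^ 2
            + 1 / (1 - ρ) * Real.log (2 * κA) ≤ (T m : ℝ))) →
      ENNReal.ofReal (1 - δ) ≤ μ {ω | ∀ m ∈ Mclass, ∀ k,
        MixedLDS.IsInferredLabel (T m) (fun t => x m t ω) (Ahat ω) (What ω) k → k = label m} := by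
  refine ⟨1 / 160, 1 / 64, 250000, by norm_num, by norm_num, by norm_num, ?_⟩
  intro Ω _ μ _ d K M A W κA ρ Γmax Wmax Wmin κself ΔΓY ΔAW T label w x Mclass pmin Ahat What
    εA εW δ κcross ι hmod hx hpmin hfrac hmeas hind hclose hδ0 hδ1 hκ hι hcase
  subst hκ hι
  -- A label absent from `Mclass` would have frequency `0 < pmin`.
  have hlabel : Function.Surjective label := by
    intro k
    have h1 := hpmin.trans_le (hfrac k)
    have h2 : (Mclass.filter fun m => label m = k).Nonempty := by
      rw [Finset.nonempty_iff_ne_empty]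
      intro h
      rw [h] at h1
      simp at h1
    obtain ⟨m, hm⟩ := h2
    exact ⟨m, (Finset.mem_filter.1 hm).2⟩
  have hΓ := hmod.Γmax_pos
  rcases hcase with ⟨h0, hA, hW, hT⟩ | ⟨h1, hlen, hA, hW, hT⟩
  -- Case 0 is `g = 1`, with the proxy `Γmax` enlarged to `3 Γmax`; Case 1 is `g = κA`.
  · refine MixedLDS.measure_correctly_classified_ge hmod hx h0.measurable_init hlabel hmeas hind
      hclose hδ0 hδ1 le_rfl (fun m t ht => (h0.isSubGaussian hx hmod ht).mono (by linarith)) ?_ hW hT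
    simpa using hA
  · refine MixedLDS.measure_correctly_classified_ge hmod hx (h1.measurable_init hx) hlabel hmeas
      hind hclose hδ0 hδ1 hmod.one_le_κA (fun m t ht => h1.isSubGaussian hx hmod hlen ht) hA hW
      fun m hm => le_trans (le_add_of_nonneg_right ?_) (hT m hm)
    have := hmod.one_le_κA
    have := hmod.ρ_lt_one
    exact mul_nonneg (one_div_nonneg.2 (by linarith)) (Real.log_nonneg (by linarith))
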